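/- Let $L$ be a first-order language and $T$ an $L$-theory; $x, y, x_i, \dots$ denote finite tuples of variables. $T$ is NIP if for every formula $\varphi(x;y)$ there is $n$ such that in no model of $T$ are there $a_1,\dots,a_n$ and $(b_S)_{S\subseteq\{1,\dots,n\}}$ with $\varphi(a_i;b_S)$ true if and only if $i\in S$. A (Keisler) measure $\mu(x)$ over a model $M$ is a finitely additive probability measure on the Boolean algebra of $M$-definable subsets of $M^{|x|}$. It is *generically stable* if for every formula $\varphi(x;y)$ and $\varepsilon>0$ there are $n\ge 1$ and $a_1,\dots,a_n\in M^{|x|}$ with $\bigl|\mu(\varphi(x;b))-\tfrac1n|\{i: M\models\varphi(a_i;b)\}|\bigr|\le\varepsilon$ for all $b\in M^{|y|}$; it is *smooth* if it has a unique extension to a measure over any elementary extension $N$ of $M$. $T$ is *distal* if it is NIP and every generically stable measure over a model of $T$ is smooth. For a measure $\omega(x_1,\dots,x_d)$ over $M$, $\omega|_{x_i}$ denotes its restriction to the variables $x_i$, and $\omega$ is a *product measure* if $\omega(A_1\times\dots\times A_d)=\prod_i\omega|_{x_i}(A_i)$ for all $M$-definable $A_i\subseteq M^{|x_i|}$. **Theorem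 2.2.** Let $T$ be distal, and let $R_y(x_1,\dots,x_d)=R(x_1,\dots,x_d;y)$ be a relation defined by an $L$-formula. For every $\alpha>0$ there are $\delta>0$ and formulas $\theta_1(x_1;z_1),\dots,\theta_d(x_d;z_d)$, depending only on $T$, $R$ and $\alpha$, such that the following holds for every model $M$ of $T$ and every product measure $\omega(x_1,\dots,x_d)$ over $M$. First, $\omega$ is generically stable if and only if it is smooth. Second, if $\omega$ is generically stable (equivalently, smooth), then for every $b\in M^{|y|}$ with $\omega(R_b)\ge\alpha$ there are parameters $c_i\in M^{|z_i|}$ such that the definable sets $A_i=\theta_i(M;c_i)\subseteq M^{|x_i|}$ satisfy $\omega|_{x_i}(A_i)>\delta$ for all $i$, and $A_1\times\dots\times A_d\subseteq R_b$. -/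

import Mathlib

open FirstOrder FirstOrder.Language

universe u v w

namespace FirstOrder.Language

/-- The set `φ(M; b)` of those tuples `a` of `M` with `M ⊨ φ(a; b)`: an instance of the partitioned
formula `φ(x; y)`, as an element of the Boolean algebra of `M`-definable sets in the variables `x`. -/
def instanceSet {L : Language.{u, v}} {M : Type w} [L.Structure M] {X Y : Type}
    (φ : L.Formula (X ⊕ Y)) (b : Y → M) : L.DefinableSet (Set.univ : Set M) X :=
  ⟨{a | φ.Realize (Sum.elim a b)}, by
    refine Set.definable_iff_exists_formula_sum.2
      ⟨φ.relabel (Sum.elim Sum.inr fun y => Sum.inl ⟨b y, Set.mem_univ _⟩), ?_⟩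
    ext a
    simp only [Set.mem_ofPred_eq, Formula.realize_relabel]
    have h : (Sum.elim (fun p : (Set.univ : Set M) => (p : M)) a) ∘
        (Sum.elim Sum.inr fun y => Sum.inl ⟨b y, Set.mem_univ _⟩) = Sum.elim a b := by
      funext z
      rcases z with z | z <;> rfl
    rw [h]⟩

/-- A Keisler measure over `M` in the variables `X`: a finitely additive probability measure on the
Boolean algebra of `M`-definable subsets of `M^X`. -/
structure KeislerMeasure (L : Language.{u, v}) (M : Type w) [L.Structure M] (X : Type) where
  /-- The measure of a definable set. -/
  meas : L.DefinableSet (Set.univ : Set M) X → ℝ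
  nonneg : ∀ D, 0 ≤ meas D
  meas_top : meas ⊤ = 1
  meas_sup : ∀ D E, Disjoint D E → meas (D ⊔ E) = meas D + meas E

namespace KeislerMeasure

variable {L : Language.{u, v}} {M : Type w} [L.Structure M] {X : Type}

/-- `μ` is generically stable: for every formula `φ(x; y)` and every `ε > 0` there is a nonempty
finite sequence `a₁, …, aₙ` in `M^X` with `|μ(φ(x; b)) - Av(a₁, …, aₙ; φ(x; b))| ≤ ε` for all `b`. -/
def IsGenericallyStable (μ : KeislerMeasure L M X) : Prop :=
  ∀ (m : ℕ) (φ : L.Formula (X ⊕ Fin m)) (ε : ℝ), 0 < ε →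
    ∃ (n : ℕ) (a : Fin n → X → M), 0 < n ∧ ∀ b : Fin m → M,
      |μ.meas (instanceSet φ b)
        - (Set.ncard {i : Fin n | φ.Realize (Sum.elim (a i) b)} : ℝ) / (n : ℝ)| ≤ ε

/-- The measure `ν` over `N` extends the measure `μ` over `M`, where `M` is seen as an elementary
submodel of `N` by means of `f`. -/
def Extends {N : Type*} [L.Structure N] (ν : KeislerMeasure L N X) (f : M ↪ₑ[L] N)
    (μ : KeislerMeasure L M X) : Prop :=
  ∀ (m : ℕ) (φ : L.Formula (X ⊕ Fin m)) (b : Fin m → M),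
    ν.meas (instanceSet φ (f ∘ b)) = μ.meas (instanceSet φ b)

/-- `μ` is smooth: it has a unique extension to any bigger model. -/
def IsSmooth (μ : KeislerMeasure L M X) : Prop :=
  ∀ (N : Type (max u v w)) [L.Structure N] (f : M ↪ₑ[L] N),
    ∃! ν : KeislerMeasure L N X, ν.Extends f μ

end KeislerMeasure

section Product

variable {L : Language.{u, v}} {M : Type w} [L.Structure M] {d : ℕ} {n : Fin d → ℕ}

/-- The cylinder `{(x₁, …, x_d) | xᵢ ∈ A}`, where `xᵢ` is the `i`-th block of variables. -/
def cylinder (i : Fin d) (A : L.DefinableSet (Set.univ : Set M) (Fin (n i))) :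
    L.DefinableSet (Set.univ : Set M) (Σ i : Fin d, Fin (n i)) :=
  ⟨{x | (fun j => x ⟨i, j⟩) ∈ (A : Set (Fin (n i) → M))},
    A.2.preimage_comp (fun j : Fin (n i) => (⟨i, j⟩ : Σ i : Fin d, Fin (n i)))⟩

/-- The product set `A₁ × ⋯ × A_d`. -/
noncomputable def box (A : ∀ i : Fin d, L.DefinableSet (Set.univ : Set M) (Fin (n i))) :
    L.DefinableSet (Set.univ : Set M) (Σ i : Fin d, Fin (n i)) :=
  Finset.univ.inf fun i => cylinder i (A i)

/-- The restriction `ω|_{xᵢ}` of `ω(x₁, …, x_d)` to the `i`-th block of variables. -/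
noncomputable def KeislerMeasure.marginal (ω : KeislerMeasure L M (Σ i : Fin d, Fin (n i))) (i : Fin d) :
    KeislerMeasure L M (Fin (n i)) where
  meas A := ω.meas (cylinder i A)
  nonneg A := ω.nonneg _
  meas_top := ω.meas_top
  meas_sup D E h := by
    refine ω.meas_sup (cylinder i D) (cylinder i E) ?_
    rw [disjoint_iff] at h ⊢
    have h' : ∀ x, ¬ (x ∈ (D : Set (Fin (n i) → M)) ∧ x ∈ (E : Set (Fin (n i) → M))) := by
      intro x hx
      have : x ∈ ((D ⊓ E : L.DefinableSet (Set.univ : Set M) (Fin (n i))) :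
          Set (Fin (n i) → M)) := hx
      rw [h] at this
      exact this
    apply Subtype.ext
    exact Set.eq_empty_iff_forall_notMem.2 fun x hx => h' _ hx

/-- `ω(x₁, …, x_d)` is a product measure: `ω(A₁ × ⋯ × A_d) = ∏ᵢ ω|_{xᵢ}(Aᵢ)`. -/
def KeislerMeasure.IsProduct (ω : KeislerMeasure L M (Σ i : Fin d, Fin (n i))) : Prop :=
  ∀ A : ∀ i : Fin d, L.DefinableSet (Set.univ : Set M) (Fin (n i)),
    ω.meas (box A) = ∏ i, (ω.marginal i).meas (A i)

end Product

/-- `T` is NIP: for every formula `φ(x; y)` there is a bound `n` such that in no model of `T` the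
formula `φ(x; y)` shatters a sequence of `n` tuples. -/
def Theory.IsNIP {L : Language.{u, v}} (T : L.Theory) : Prop :=
  ∀ (k m : ℕ) (φ : L.Formula (Fin k ⊕ Fin m)), ∃ n : ℕ, ∀ M : Theory.ModelType.{u, v, max u v} T,
    ¬ ∃ (a : Fin n → Fin k → M) (b : Set (Fin n) → Fin m → M),
      ∀ (i : Fin n) (S : Set (Fin n)), φ.Realize (Sum.elim (a i) (b S)) ↔ i ∈ S

/-- `T` is distal: it is NIP, and all generically stable measures over models of `T` (in finitely
many variables) are smooth. -/
def Theory.IsDistal {L : Language.{u, v}} (T : L.Theory) : Prop :=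
  T.IsNIP ∧ ∀ (M : Theory.ModelType.{u, v, max u v} T) (X : Type) [Finite X]
    (μ : KeislerMeasure L M X), μ.IsGenericallyStable → μ.IsSmooth

end FirstOrder.Language

-- Uniformity over all models comes from compactness. If every candidate for the bound and the
-- formulas fails in some model, an ultraproduct of the counterexamples carries a product measure
-- giving `R` measure at least `α`. Two facts lead to a contradiction: generic stability passes to
-- the ultraproduct, and in a single model every set of positive measure contains a box with sides
-- of positive measure. The formulas and the bound of such a box in the ultraproduct then work in
-- almost all factors.
--
-- The first fact uses NIP. By the Vapnik–Chervonenkis theorem (`exists_average_near_average`) the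
-- number of points approximating a measure on the instances of `φ` up to `ε` depends on `φ` and `ε`
-- alone, so the approximations in the factors have one common length
-- (`IsGenericallyStable.ultraproduct`).
--
-- The second fact uses distality: the marginals are generically stable, so their extensions are
-- unique (`Theory.IsDistal.uniqueExtension`). Since some extension attains the outer measure of any
-- given set, uniqueness makes inner and outer measure agree (`UniqueExtension.exists_sandwich`),
-- and an ultrapower argument yields finitely many pairs that sandwich all instances of a formula up
-- to `ε` (`UniqueExtension.exists_cutting`). Applied to the fibres of a set over one block of
-- variables, this reduces the set to products with sets in fewer blocks, and induction finds the
-- box (`IsProduct.dependsOn_induction`). The same cutting shows that smooth measures are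
-- generically stable.

universe w'

namespace FirstOrder.Language

/-! ### Definable sets and measures along elementary embeddings. -/

section Basic

variable {L : Language.{u, v}} {M : Type w} [L.Structure M] {N : Type w'} [L.Structure N]
  {X Y Y' : Type}

theorem mem_instanceSet {φ : L.Formula (X ⊕ Y)} {b : Y → M} {a : X → M} :
    a ∈ instanceSet φ b ↔ φ.Realize (Sum.elim a b) := Iff.rfl

theorem exists_eq_instanceSet (D : L.DefinableSet (Set.univ : Set M) X) :
    ∃ (m : ℕ) (φ : L.Formula (X ⊕ Fin m)) (b : Fin m → M), D = instanceSet φ b := by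
  obtain ⟨A, -, hA⟩ := Set.definable_iff_finitely_definable.1 D.2
  obtain ⟨φ, hφ⟩ := Set.definable_iff_exists_formula_sum.1 hA
  let e : (A : Set M) ≃ Fin A.card := A.equivFin
  refine ⟨A.card, φ.relabel (Sum.elim (fun a => Sum.inr (e a)) Sum.inl), fun i => e.symm i, ?_⟩
  apply SetLike.ext
  intro a
  rw [mem_instanceSet, Formula.realize_relabel]
  have h1 : a ∈ D ↔ a ∈ (D : Set (X → M)) := Iff.rfl
  rw [h1]
  change a ∈ D.1 ↔ _
  rw [hφ]
  have : (Sum.elim a fun i => ((e.symm i : (A : Set M)) : M)) ∘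
      (Sum.elim (fun a => Sum.inr (e a)) Sum.inl) =
      Sum.elim (fun p : (A : Set M) => (p : M)) a := by
    funext z
    rcases z with z | z <;> simp
  rw [this]
  rfl

/-- The instances of the first formula are contained in those of the second one. -/
noncomputable def instanceLE [Finite X] (φ : L.Formula (X ⊕ Y)) (ψ : L.Formula (X ⊕ Y')) :
    L.Formula (Y ⊕ Y') :=
  Formula.iAlls X ((φ.relabel (Sum.elim Sum.inr (Sum.inl ∘ Sum.inl))).imp
    (ψ.relabel (Sum.elim Sum.inr (Sum.inl ∘ Sum.inr))) : L.Formula ((Y ⊕ Y') ⊕ X))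

theorem realize_instanceLE [Finite X] (φ : L.Formula (X ⊕ Y)) (ψ : L.Formula (X ⊕ Y'))
    (b : Y → M) (c : Y' → M) :
    (instanceLE φ ψ).Realize (Sum.elim b c) ↔ instanceSet φ b ≤ instanceSet ψ c := by
  have h1 : ∀ a : X → M, (Sum.elim (Sum.elim b c) a) ∘
      (Sum.elim Sum.inr (Sum.inl ∘ Sum.inl)) = Sum.elim a b := by
    intro a; funext z; rcases z with z | z <;> rfl
  have h2 : ∀ a : X → M, (Sum.elim (Sum.elim b c) a) ∘
      (Sum.elim Sum.inr (Sum.inl ∘ Sum.inr)) = Sum.elim a c := by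
    intro a; funext z; rcases z with z | z <;> rfl
  rw [instanceLE, Formula.realize_iAlls]
  simp only [Formula.realize_imp, Formula.realize_relabel, h1, h2]
  rfl

theorem instanceSet_map_le_iff [Finite X] (f : M ↪ₑ[L] N) (φ : L.Formula (X ⊕ Y))
    (ψ : L.Formula (X ⊕ Y')) (b : Y → M) (c : Y' → M) :
    instanceSet φ (f ∘ b) ≤ instanceSet ψ (f ∘ c) ↔ instanceSet φ b ≤ instanceSet ψ c := by
  rw [← realize_instanceLE, ← realize_instanceLE, ← f.map_formula, Sum.comp_elim]

theorem instanceSet_sup (φ : L.Formula (X ⊕ Y)) (ψ : L.Formula (X ⊕ Y'))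
    (b : Y → M) (c : Y' → M) :
    instanceSet φ b ⊔ instanceSet ψ c =
      instanceSet (φ.relabel (Sum.map id Sum.inl) ⊔ ψ.relabel (Sum.map id Sum.inr) :
        L.Formula (X ⊕ (Y ⊕ Y'))) (Sum.elim b c) := by
  apply SetLike.ext
  intro a
  rw [DefinableSet.mem_sup, mem_instanceSet, mem_instanceSet, mem_instanceSet,
    Formula.realize_sup, Formula.realize_relabel, Formula.realize_relabel,
    Sum.elim_comp_map, Sum.elim_comp_map]
  simp

theorem instanceSet_compl (φ : L.Formula (X ⊕ Y)) (b : Y → M) :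
    (instanceSet φ b)ᶜ = instanceSet φ.not b := by
  apply SetLike.ext
  intro a
  rw [DefinableSet.mem_compl, mem_instanceSet, mem_instanceSet, Formula.realize_not]

/-- The set defined in `N` by the same formula as a definable set in `M`. -/
noncomputable def DefinableSet.lift (f : M ↪ₑ[L] N) (D : L.DefinableSet (Set.univ : Set M) X) :
    L.DefinableSet (Set.univ : Set N) X :=
  instanceSet (exists_eq_instanceSet D).choose_spec.choose
    (f ∘ (exists_eq_instanceSet D).choose_spec.choose_spec.choose)

namespace DefinableSet

variable [Finite X] (f : M ↪ₑ[L] N)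

/-- The formula chosen in `lift` does not matter: inclusion between two instances is a first-order
condition on their parameters, so elementary embeddings preserve it. -/
theorem lift_instanceSet (φ : L.Formula (X ⊕ Y)) (b : Y → M) :
    lift f (instanceSet φ b) = instanceSet φ (f ∘ b) := by
  have h := (exists_eq_instanceSet (instanceSet φ b)).choose_spec.choose_spec.choose_spec
  apply le_antisymm
  · exact (instanceSet_map_le_iff f _ _ _ _).2 h.ge
  · exact (instanceSet_map_le_iff f _ _ _ _).2 h.le

theorem lift_le_iff {D E : L.DefinableSet (Set.univ : Set M) X} :
    lift f D ≤ lift f E ↔ D ≤ E := by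
  obtain ⟨m, φ, b, rfl⟩ := exists_eq_instanceSet D
  obtain ⟨k, ψ, c, rfl⟩ := exists_eq_instanceSet E
  rw [lift_instanceSet, lift_instanceSet, instanceSet_map_le_iff]

theorem lift_sup (D E : L.DefinableSet (Set.univ : Set M) X) :
    lift f (D ⊔ E) = lift f D ⊔ lift f E := by
  obtain ⟨m, φ, b, rfl⟩ := exists_eq_instanceSet D
  obtain ⟨k, ψ, c, rfl⟩ := exists_eq_instanceSet E
  rw [instanceSet_sup, lift_instanceSet, lift_instanceSet, lift_instanceSet, instanceSet_sup,
    Sum.comp_elim]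

theorem lift_compl (D : L.DefinableSet (Set.univ : Set M) X) :
    lift f Dᶜ = (lift f D)ᶜ := by
  obtain ⟨m, φ, b, rfl⟩ := exists_eq_instanceSet D
  rw [instanceSet_compl, lift_instanceSet, lift_instanceSet, instanceSet_compl]

theorem lift_inf (D E : L.DefinableSet (Set.univ : Set M) X) :
    lift f (D ⊓ E) = lift f D ⊓ lift f E := by
  rw [← compl_inj_iff, compl_inf, ← lift_compl, compl_inf, lift_sup, lift_compl, lift_compl]

theorem lift_top : lift f (⊤ : L.DefinableSet (Set.univ : Set M) X) = ⊤ := by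
  have h := lift_sup f (⊤ : L.DefinableSet (Set.univ : Set M) X) ⊤ᶜ
  rw [sup_compl_eq_top, lift_compl, sup_compl_eq_top] at h
  exact h

theorem lift_bot : lift f (⊥ : L.DefinableSet (Set.univ : Set M) X) = ⊥ := by
  rw [← compl_top, lift_compl, lift_top, compl_top]

theorem lift_comp {P : Type*} [L.Structure P] (g : N ↪ₑ[L] P)
    (D : L.DefinableSet (Set.univ : Set M) X) : lift (g.comp f) D = lift g (lift f D) := by
  obtain ⟨m, φ, b, rfl⟩ := exists_eq_instanceSet D
  rw [lift_instanceSet, lift_instanceSet, lift_instanceSet]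
  rfl

end DefinableSet

namespace KeislerMeasure

@[ext]
theorem ext {μ ν : KeislerMeasure L M X} (h : ∀ D, μ.meas D = ν.meas D) : μ = ν := by
  cases μ
  cases ν
  congr
  exact funext h

section

variable (μ : KeislerMeasure L M X)

theorem meas_bot : μ.meas ⊥ = 0 := by
  have h := μ.meas_sup ⊥ ⊥ disjoint_bot_left
  rw [sup_idem] at h
  linarith

theorem meas_inf_add_sdiff (D E) : μ.meas (D ⊓ E) + μ.meas (D \ E) = μ.meas D := by
  rw [← μ.meas_sup _ _ disjoint_inf_sdiff, sup_inf_sdiff]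

theorem meas_inf_add_compl (D E) : μ.meas (D ⊓ E) + μ.meas (D ⊓ Eᶜ) = μ.meas D := by
  rw [← sdiff_eq, meas_inf_add_sdiff]

theorem meas_mono {D E} (h : D ≤ E) : μ.meas D ≤ μ.meas E := by
  rw [← μ.meas_inf_add_sdiff E D, inf_eq_right.2 h]
  linarith [μ.nonneg (E \ D)]

theorem meas_le_one (D) : μ.meas D ≤ 1 := μ.meas_top ▸ μ.meas_mono le_top

theorem meas_compl (D) : μ.meas Dᶜ = 1 - μ.meas D := by
  have h := μ.meas_inf_add_compl ⊤ D
  rw [top_inf_eq, top_inf_eq, μ.meas_top] at h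
  linarith

theorem meas_finset_sup {ι : Type*} (s : Finset ι) (D : ι → L.DefinableSet (Set.univ : Set M) X)
    (h : (s : Set ι).PairwiseDisjoint D) : μ.meas (s.sup D) = ∑ i ∈ s, μ.meas (D i) := by
  classical
  induction s using Finset.induction_on with
  | empty => simpa using μ.meas_bot
  | insert a s ha ih =>
    rw [Finset.sup_insert, Finset.sum_insert ha, μ.meas_sup, ih]
    · exact h.subset (by simp)
    · rw [Finset.disjoint_sup_right]
      intro i hi
      exact h (by simp) (by simp [hi]) (by rintro rfl; exact ha hi)

end

theorem extends_iff [Finite X] {ν : KeislerMeasure L N X} {f : M ↪ₑ[L] N}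
    {μ : KeislerMeasure L M X} :
    ν.Extends f μ ↔ ∀ D, ν.meas (D.lift f) = μ.meas D := by
  constructor
  · intro h D
    obtain ⟨m, φ, b, rfl⟩ := exists_eq_instanceSet D
    rw [DefinableSet.lift_instanceSet, h]
  · intro h m φ b
    rw [← h, DefinableSet.lift_instanceSet]

/-- The restriction of a measure to an elementary submodel. -/
noncomputable def comap [Finite X] (f : M ↪ₑ[L] N) (ν : KeislerMeasure L N X) :
    KeislerMeasure L M X where
  meas D := ν.meas (D.lift f)
  nonneg D := ν.nonneg _
  meas_top := by rw [DefinableSet.lift_top, ν.meas_top]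
  meas_sup D E h := by
    rw [DefinableSet.lift_sup]
    apply ν.meas_sup
    rw [disjoint_iff, ← DefinableSet.lift_inf, disjoint_iff.1 h, DefinableSet.lift_bot]

/-- `μ` has at most one extension along any elementary embedding into a model in `Type w'`. -/
def UniqueExtension (μ : KeislerMeasure L M X) : Prop :=
  ∀ (N : Type w') [L.Structure N] (f : M ↪ₑ[L] N) (ν ν' : KeislerMeasure L N X),
    ν.Extends f μ → ν'.Extends f μ → ν = ν'

end KeislerMeasure

end Basic

/-! ### Finitely supported approximations and extensions of measures. -/

theorem exists_tendsto_ultrafilter {I : Type*} (U : Ultrafilter I) {f : I → ℝ}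
    (hf : ∀ i, 0 ≤ f i ∧ f i ≤ 1) : ∃ r, Filter.Tendsto f U (nhds r) := by
  obtain ⟨r, -, hr⟩ := (isCompact_Icc (a := (0 : ℝ)) (b := 1)).ultrafilter_le_nhds (U.map f)
    (Filter.le_principal_iff.2 (Filter.mem_map.2 (Filter.univ_mem' hf)))
  exact ⟨r, hr⟩

section Mass

variable {Ω : Type*}

open Classical in
/-- The mass that a finite family of weighted points gives to a set. -/
noncomputable def pointMass (p : Ω →₀ ℝ) (S : Set Ω) : ℝ :=
  p.sum fun a r => if a ∈ S then r else 0

theorem pointMass_add (p q : Ω →₀ ℝ) (S : Set Ω) :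
    pointMass (p + q) S = pointMass p S + pointMass q S := by
  classical
  apply Finsupp.sum_add_index'
  · intro a; simp
  · intro a r s; split_ifs <;> simp

open Classical in
theorem pointMass_single (a : Ω) (r : ℝ) (S : Set Ω) :
    pointMass (Finsupp.single a r) S = if a ∈ S then r else 0 := by
  rw [pointMass, Finsupp.sum_single_index (by simp)]

theorem pointMass_zero (S : Set Ω) : pointMass 0 S = 0 := by
  classical
  exact Finsupp.sum_zero_index

theorem pointMass_nonneg {p : Ω →₀ ℝ} (hp : ∀ a, 0 ≤ p a) (S : Set Ω) : 0 ≤ pointMass p S := by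
  classical
  apply Finset.sum_nonneg
  intro a _
  dsimp only
  split_ifs
  · exact hp a
  · exact le_rfl

theorem pointMass_union (p : Ω →₀ ℝ) {S T : Set Ω} (h : Disjoint S T) :
    pointMass p (S ∪ T) = pointMass p S + pointMass p T := by
  classical
  rw [pointMass, pointMass, pointMass, ← Finsupp.sum_add]
  congr 1
  funext a r
  have : a ∈ S → a ∉ T := fun h1 h2 => Set.disjoint_left.1 h h1 h2
  by_cases h1 : a ∈ S <;> by_cases h2 : a ∈ T <;> simp_all

theorem pointMass_congr {p : Ω →₀ ℝ} {S T : Set Ω}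
    (h : ∀ a, p a ≠ 0 → (a ∈ S ↔ a ∈ T)) : pointMass p S = pointMass p T := by
  classical
  apply Finset.sum_congr rfl
  intro a ha
  simp only [h a (Finsupp.mem_support_iff.1 ha)]

end Mass

namespace KeislerMeasure

variable {L : Language.{u, v}} {M : Type w} [L.Structure M] {N : Type w'} [L.Structure N]
  {X : Type} [Finite X]

/-- Each piece into which `F` cuts `D` has its mass put on one point of its lift, a point of `c`
whenever the lift meets `c`. Then `c` receives the mass of all pieces that meet it, and these cover
the part of `c` in the lift of `D`. The set `D` is arbitrary so that the induction can split it by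
the new member of `F`. -/
theorem exists_pointMass (μ : KeislerMeasure L M X) (f : M ↪ₑ[L] N) (c : Set (X → N))
    (F : Finset (L.DefinableSet (Set.univ : Set M) X)) :
    ∀ D : L.DefinableSet (Set.univ : Set M) X, ∃ p : (X → N) →₀ ℝ,
      (∀ a, 0 ≤ p a) ∧ (∀ a, p a ≠ 0 → a ∈ D.lift f) ∧
      pointMass p Set.univ = μ.meas D ∧
      (∀ θ ∈ F, pointMass p (θ.lift f : Set (X → N)) = μ.meas (D ⊓ θ)) ∧
      ∃ θ : L.DefinableSet (Set.univ : Set M) X,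
        (∀ a ∈ c, a ∈ D.lift f → a ∈ θ.lift f) ∧ pointMass p c = μ.meas (D ⊓ θ) := by
  classical
  induction F using Finset.induction_on with
  | empty =>
    intro D
    by_cases hc : ∃ a ∈ c, a ∈ D.lift f
    · obtain ⟨a, hac, haD⟩ := hc
      refine ⟨Finsupp.single a (μ.meas D), ?_, ?_, ?_, by simp, ⊤, ?_, ?_⟩
      · intro b
        rw [Finsupp.single_apply]
        split_ifs
        exacts [μ.nonneg D, le_rfl]
      · intro b hb
        rw [Finsupp.single_apply] at hb
        split_ifs at hb with h
        · exact h ▸ haD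
        · exact (hb rfl).elim
      · rw [pointMass_single, if_pos (Set.mem_univ _)]
      · intro b _ _
        rw [DefinableSet.lift_top]
        exact DefinableSet.mem_top
      · rw [pointMass_single, if_pos hac, inf_top_eq]
    · by_cases hD : ∃ a, a ∈ D.lift f
      · obtain ⟨a, haD⟩ := hD
        have hac : a ∉ c := fun h => hc ⟨a, h, haD⟩
        refine ⟨Finsupp.single a (μ.meas D), ?_, ?_, ?_, by simp, ⊥, ?_, ?_⟩
        · intro b
          rw [Finsupp.single_apply]
          split_ifs
          exacts [μ.nonneg D, le_rfl]
        · intro b hb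
          rw [Finsupp.single_apply] at hb
          split_ifs at hb with h
          · exact h ▸ haD
          · exact (hb rfl).elim
        · rw [pointMass_single, if_pos (Set.mem_univ _)]
        · intro b hb hb'
          exact (hc ⟨b, hb, hb'⟩).elim
        · rw [pointMass_single, if_neg hac, inf_bot_eq, meas_bot]
      · have hD0 : D = ⊥ := by
          rw [← le_bot_iff, ← DefinableSet.lift_le_iff f]
          intro a ha
          exact (hD ⟨a, ha⟩).elim
        subst hD0
        refine ⟨0, by simp, by simp, ?_, by simp, ⊥, ?_, ?_⟩
        · rw [pointMass_zero, meas_bot]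
        · intro a _ ha
          exact ha
        · rw [pointMass_zero, inf_bot_eq, meas_bot]
  | insert θ F hθ ih =>
    intro D
    obtain ⟨p, hp0, hpD, hp1, hpF, χ, hχ, hpc⟩ := ih (D ⊓ θ)
    obtain ⟨q, hq0, hqD, hq1, hqF, ξ, hξ, hqc⟩ := ih (D ⊓ θᶜ)
    simp only [DefinableSet.lift_inf, DefinableSet.lift_compl, DefinableSet.mem_inf,
      DefinableSet.mem_compl] at hpD hqD hχ hξ
    have key : ∀ η, μ.meas (D ⊓ θ ⊓ η) + μ.meas (D ⊓ θᶜ ⊓ η) = μ.meas (D ⊓ η) := by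
      intro η
      rw [← μ.meas_inf_add_compl (D ⊓ η) θ]
      congr 2 <;> rw [inf_right_comm]
    refine ⟨p + q, fun a => add_nonneg (hp0 a) (hq0 a), ?_, ?_, ?_,
      (θ ⊓ χ) ⊔ (θᶜ ⊓ ξ), ?_, ?_⟩
    · intro a ha
      by_cases h : p a = 0
      · have : q a ≠ 0 := by
          intro h'
          exact ha (by rw [Finsupp.add_apply, h, h', add_zero])
        exact (hqD a this).1
      · exact (hpD a h).1
    · rw [pointMass_add, hp1, hq1, meas_inf_add_compl]
    · intro η hη
      rw [pointMass_add]
      rcases Finset.mem_insert.1 hη with rfl | hη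
      · rw [← hp1, pointMass_congr (S := (η.lift f : Set (X → N))) (T := Set.univ),
          pointMass_congr (p := q) (S := (η.lift f : Set (X → N))) (T := ∅)]
        · simp [pointMass]
        · intro a ha
          simpa using (hqD a ha).2
        · intro a ha
          simpa using (hpD a ha).2
      · rw [hpF η hη, hqF η hη, key]
    · intro a hac haD
      simp only [DefinableSet.lift_sup, DefinableSet.lift_inf, DefinableSet.lift_compl,
        DefinableSet.mem_inf, DefinableSet.mem_sup, DefinableSet.mem_compl]
      by_cases h : a ∈ θ.lift f
      · exact Or.inl ⟨h, hχ a hac ⟨haD, h⟩⟩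
      · exact Or.inr ⟨h, hξ a hac ⟨haD, h⟩⟩
    · rw [pointMass_add, hpc, hqc, ← μ.meas_inf_add_compl (D ⊓ _) θ]
      congr 2
      · apply SetLike.ext
        intro a
        simp only [DefinableSet.mem_inf, DefinableSet.mem_sup, DefinableSet.mem_compl]
        tauto
      · apply SetLike.ext
        intro a
        simp only [DefinableSet.mem_inf, DefinableSet.mem_sup, DefinableSet.mem_compl]
        tauto

/-- A measure extends to any elementary extension, with the outer measure as the value at a given
definable set. -/
theorem exists_extends (μ : KeislerMeasure L M X) (f : M ↪ₑ[L] N)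
    (c : L.DefinableSet (Set.univ : Set N) X) :
    ∃ ν : KeislerMeasure L N X, ν.Extends f μ ∧
      ∀ r, (∀ θ : L.DefinableSet (Set.univ : Set M) X, c ≤ θ.lift f → r ≤ μ.meas θ) →
        r ≤ ν.meas c := by
  classical
  have h := fun F => μ.exists_pointMass f (c : Set (X → N)) F ⊤
  choose p hp0 _ hp1 hpF χ hχ hpc using h
  -- In the limit over growing `F` each definable set of `M` keeps its exact value, which is right
  -- as soon as the set belongs to `F`. At every stage the mass of `c` is that of a set `χ F` whose
  -- lift covers `c`, so the limit is at least the outer measure.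
  let U : Ultrafilter (Finset (L.DefinableSet (Set.univ : Set M) X)) := Ultrafilter.of Filter.atTop
  have hU : (U : Filter (Finset (L.DefinableSet (Set.univ : Set M) X))) ≤ Filter.atTop :=
    Ultrafilter.of_le _
  have hle : ∀ F (S : Set (X → N)), 0 ≤ pointMass (p F) S ∧ pointMass (p F) S ≤ 1 := by
    intro F S
    refine ⟨pointMass_nonneg (hp0 F) S, ?_⟩
    have h1 := pointMass_union (p F) (disjoint_compl_right (a := S))
    rw [Set.union_compl_self, hp1, μ.meas_top] at h1
    linarith [pointMass_nonneg (hp0 F) Sᶜ]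
  choose m hm using fun S => exists_tendsto_ultrafilter U (fun F => hle F S)
  let ν : KeislerMeasure L N X :=
    { meas := fun D => m D
      nonneg := fun D => ge_of_tendsto' (hm _) fun F => (hle F _).1
      meas_top := by
        refine tendsto_nhds_unique (hm _) ?_
        refine tendsto_const_nhds.congr fun F => ?_
        rw [DefinableSet.coe_top, hp1, μ.meas_top]
      meas_sup := by
        intro D E hDE
        refine tendsto_nhds_unique (hm _) (((hm _).add (hm _)).congr fun F => ?_)
        rw [DefinableSet.coe_sup, pointMass_union]
        rw [Set.disjoint_iff_inter_eq_empty, ← DefinableSet.coe_inf, disjoint_iff.1 hDE,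
          DefinableSet.coe_bot] }
  refine ⟨ν, extends_iff.2 fun D => ?_, fun r hr => ?_⟩
  · refine tendsto_nhds_unique (hm _) (tendsto_const_nhds.congr' ?_)
    filter_upwards [hU (Filter.mem_atTop {D})] with F hF
    rw [hpF F D (hF (Finset.mem_singleton_self D)), top_inf_eq]
  · refine ge_of_tendsto' (hm _) fun F => ?_
    rw [hpc, top_inf_eq]
    apply hr
    intro a ha
    exact hχ F a ha (by rw [DefinableSet.lift_top]; exact DefinableSet.mem_top)

/-- One extension attains the outer measure of `c` and another that of `cᶜ`. As they coincide, the
two outer measures add up to 1, so inner and outer measure of `c` are equal. -/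
theorem UniqueExtension.exists_sandwich {μ : KeislerMeasure L M X}
    (hμ : UniqueExtension.{u, v, w, w'} μ) (f : M ↪ₑ[L] N)
    (c : L.DefinableSet (Set.univ : Set N) X) {ε : ℝ} (hε : 0 < ε) :
    ∃ θ₀ θ₁ : L.DefinableSet (Set.univ : Set M) X, θ₀.lift f ≤ c ∧ c ≤ θ₁.lift f ∧
      μ.meas θ₁ - μ.meas θ₀ < ε := by
  have key : ∀ c : L.DefinableSet (Set.univ : Set N) X, ∃ (ν : KeislerMeasure L N X)
      (θ : L.DefinableSet (Set.univ : Set M) X), ν.Extends f μ ∧ c ≤ θ.lift f ∧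
        μ.meas θ < ν.meas c + ε / 2 := by
    intro c
    obtain ⟨ν, hν, h⟩ := μ.exists_extends f c
    by_contra hne
    push Not at hne
    have := h (ν.meas c + ε / 2) fun θ hθ => hne ν θ hν hθ
    linarith
  obtain ⟨ν, θ, hν, hθ, h⟩ := key c
  obtain ⟨ν', θ', hν', hθ', h'⟩ := key cᶜ
  obtain rfl := hμ N f ν ν' hν hν'
  refine ⟨θ'ᶜ, θ, ?_, hθ, ?_⟩
  · rw [DefinableSet.lift_compl]
    exact compl_le_of_compl_le hθ'
  · rw [meas_compl] at h' ⊢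
    linarith

end KeislerMeasure

/-! ### Averages of finite sequences. -/

theorem DefinableSet.lift_refl {L : Language.{u, v}} {M : Type w} [L.Structure M]
    {X : Type} [Finite X] (D : L.DefinableSet (Set.univ : Set M) X) :
    D.lift (ElementaryEmbedding.refl L M) = D := by
  obtain ⟨m, φ, b, rfl⟩ := exists_eq_instanceSet D
  rw [DefinableSet.lift_instanceSet]
  rfl

open Classical in
/-- Finitely many weighted points can be replaced by the average of a finite sequence. -/
theorem exists_average_near_pointMass {Ω : Type*} (p : Ω →₀ ℝ) (hp : ∀ a, 0 ≤ p a)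
    (hp1 : pointMass p Set.univ = 1) {ε : ℝ} (hε : 0 < ε) {n : ℕ}
    (hn : (p.support.card : ℝ) < n * ε) :
    ∃ a : Fin n → Ω, ∀ S : Set Ω,
      |pointMass p S - (Set.ncard {i | a i ∈ S} : ℝ) / n| ≤ ε := by
  set K := p.support.card with hK
  have hn0 : (0 : ℝ) < n := pos_of_mul_pos_left (lt_of_le_of_lt (by positivity) hn) hε.le
  have hne : p.support.Nonempty := by
    rw [Finset.nonempty_iff_ne_empty]
    intro h
    simp [pointMass, Finsupp.sum, h] at hp1
  obtain ⟨o, -⟩ := hne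
  -- Rounding down loses less than one copy per point of the support. So at most `K` of the `n`
  -- places remain; they are filled with the arbitrary point `o`, and the error is at most `K / n <
  -- ε`.
  let k : Ω → ℕ := fun a => ⌊n * p a⌋₊
  let T := Σ a : p.support, Fin (k a)
  have hmass : ∀ S : Set Ω, pointMass p S = ∑ a ∈ p.support with a ∈ S, p a := by
    intro S
    rw [pointMass, Finsupp.sum, Finset.sum_filter]
  have hle : ∀ S : Set Ω, (∑ a ∈ p.support with a ∈ S, (k a : ℝ)) ≤ n * pointMass p S := by
    intro S
    rw [hmass, Finset.mul_sum]
    exact Finset.sum_le_sum fun a _ => Nat.floor_le (mul_nonneg hn0.le (hp a))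
  have hge : ∀ S : Set Ω, n * pointMass p S - K ≤ ∑ a ∈ p.support with a ∈ S, (k a : ℝ) := by
    intro S
    have h1 : ∑ a ∈ p.support with a ∈ S, (n * p a - 1) ≤
        ∑ a ∈ p.support with a ∈ S, (k a : ℝ) :=
      Finset.sum_le_sum fun a _ => by
        have := Nat.lt_floor_add_one (n * p a)
        simp only [k]
        linarith
    rw [Finset.sum_sub_distrib, ← Finset.mul_sum, ← hmass] at h1
    have h2 : ∑ a ∈ p.support with a ∈ S, (1 : ℝ) ≤ K := by
      rw [Finset.sum_const, nsmul_eq_mul, mul_one]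
      exact_mod_cast Finset.card_filter_le _ _
    linarith
  have hsum : ∀ S : Set Ω, (Set.ncard {t : T | (t.1 : Ω) ∈ S} : ℝ) =
      ∑ a ∈ p.support with a ∈ S, (k a : ℝ) := by
    intro S
    have : {t : T | (t.1 : Ω) ∈ S} = ((Finset.univ.filter fun a : p.support => (a : Ω) ∈ S).sigma
        fun a => (Finset.univ : Finset (Fin (k a))) : Finset T) := by
      ext t
      refine ⟨fun h => Finset.mem_sigma.2 ⟨?_, Finset.mem_univ _⟩, fun h => ?_⟩
      · simpa using h
      · simpa using (Finset.mem_sigma.1 h).1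
    rw [this, Set.ncard_coe_finset, Finset.card_sigma]
    push_cast
    simp only [Finset.card_univ, Fintype.card_fin]
    rw [Finset.sum_filter, Finset.sum_filter, ← Finset.sum_coe_sort p.support]
  have hcard : Fintype.card T ≤ n := by
    have h1 := hsum Set.univ
    have h2 := hle Set.univ
    rw [hp1, mul_one, ← h1] at h2
    have h3 : {t : T | (t.1 : Ω) ∈ Set.univ} = Set.univ := by ext t; simp
    rw [h3, Set.ncard_univ, Nat.card_eq_fintype_card] at h2
    exact_mod_cast h2
  have hcardE : Fintype.card (T ⊕ Fin (n - Fintype.card T)) = n := by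
    simp only [Fintype.card_sum, Fintype.card_fin]
    omega
  have hrest : ((n - Fintype.card T : ℕ) : ℝ) ≤ K := by
    have h1 := hsum Set.univ
    have h2 := hge Set.univ
    have h3 : {t : T | (t.1 : Ω) ∈ Set.univ} = Set.univ := by ext t; simp
    rw [hp1, mul_one, ← h1, h3, Set.ncard_univ, Nat.card_eq_fintype_card] at h2
    rw [Nat.cast_sub hcard]
    linarith
  let e : T ⊕ Fin (n - Fintype.card T) ≃ Fin n := Fintype.equivFinOfCardEq hcardE
  let g : T ⊕ Fin (n - Fintype.card T) → Ω := Sum.elim (fun t => t.1) fun _ => o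
  refine ⟨g ∘ e.symm, fun S => ?_⟩
  have hc : Set.ncard {i | (g ∘ e.symm) i ∈ S} = Set.ncard {t : T | (t.1 : Ω) ∈ S} +
      Set.ncard {j : Fin (n - Fintype.card T) | o ∈ S} := by
    have h1 : {i | (g ∘ e.symm) i ∈ S} = e '' (Sum.inl '' {t : T | (t.1 : Ω) ∈ S} ∪
        Sum.inr '' {j : Fin (n - Fintype.card T) | o ∈ S}) := by
      rw [e.image_eq_preimage_symm]
      ext i
      simp only [Set.mem_ofPred_eq, Set.mem_preimage, Function.comp]
      rcases e.symm i with t | t <;> simp [g]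
    rw [h1, Set.ncard_image_of_injective _ e.injective, Set.ncard_union_eq,
      Set.ncard_image_of_injective _ Sum.inl_injective,
      Set.ncard_image_of_injective _ Sum.inr_injective]
    rw [Set.disjoint_left]
    rintro _ ⟨t, -, rfl⟩ ⟨t', -, h⟩
    cases h
  have hc2 : (Set.ncard {j : Fin (n - Fintype.card T) | o ∈ S} : ℝ) ≤ K := by
    refine le_trans ?_ hrest
    have := Set.ncard_le_card {j : Fin (n - Fintype.card T) | o ∈ S}
    rw [Nat.card_eq_fintype_card, Fintype.card_fin] at this
    exact_mod_cast this
  have hc' : (Set.ncard {i | (g ∘ e.symm) i ∈ S} : ℝ) =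
      (∑ a ∈ p.support with a ∈ S, (k a : ℝ)) +
      (Set.ncard {j : Fin (n - Fintype.card T) | o ∈ S} : ℝ) := by
    rw [hc, ← hsum]
    push_cast
    rfl
  have h1 := hle S
  have h2 := hge S
  have h0 : (0 : ℝ) ≤ (Set.ncard {j : Fin (n - Fintype.card T) | o ∈ S} : ℝ) := by positivity
  rw [abs_le]
  constructor
  · rw [neg_le_sub_iff_le_add, div_le_iff₀ hn0]
    nlinarith
  · rw [sub_le_comm, le_div_iff₀ hn0]
    nlinarith

theorem KeislerMeasure.exists_average {L : Language.{u, v}} {M : Type w} [L.Structure M]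
    {X : Type} [Finite X] (μ : KeislerMeasure L M X)
    (F : Finset (L.DefinableSet (Set.univ : Set M) X)) {ε : ℝ} (hε : 0 < ε) :
    ∃ (n : ℕ) (a : Fin n → X → M), 0 < n ∧ ∀ θ ∈ F,
      |μ.meas θ - (Set.ncard {i | a i ∈ θ} : ℝ) / n| ≤ ε := by
  obtain ⟨p, hp0, -, hp1, hpF, -⟩ :=
    μ.exists_pointMass (ElementaryEmbedding.refl L M) ∅ F ⊤
  rw [μ.meas_top] at hp1
  obtain ⟨n, hn⟩ := exists_nat_gt ((p.support.card : ℝ) / ε)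
  have hn0 : (0 : ℝ) < n := lt_of_le_of_lt (by positivity) hn
  rw [div_lt_iff₀ hε] at hn
  obtain ⟨a, h⟩ := exists_average_near_pointMass p hp0 hp1 hε hn
  refine ⟨n, a, by exact_mod_cast hn0, fun θ hθ => ?_⟩
  have h1 := h θ
  have h2 := hpF θ hθ
  rw [DefinableSet.lift_refl, top_inf_eq] at h2
  rw [h2] at h1
  exact h1

/-! ### Descent to small models. -/

theorem exists_small_elementaryEmbedding {L : Language.{u, v}} {M : Type w} [L.Structure M]
    [Nonempty M] (s : Set M) [Small.{max u v} s] :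
    ∃ (M₀ : Type (max u v)) (_ : L.Structure M₀) (f : M₀ ↪ₑ[L] M), s ⊆ Set.range f := by
  let C := Substructure.closure (L.sum L.skolem₁) s
  let S := Substructure.elementarySkolem₁Reduct (C : (L.sum L.skolem₁).Substructure M)
  have hsmall : Small.{max u v} S := by
    rw [Substructure.coeSort_elementarySkolem₁Reduct]
    infer_instance
  let e := equivShrink S
  let _ : L.Structure (Shrink.{max u v} S) := e.inducedStructure
  refine ⟨Shrink.{max u v} S, inferInstance,
    S.subtype.comp (e.inducedStructureEquiv (L := L)).symm.toElementaryEmbedding, ?_⟩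
  intro a ha
  have haS : a ∈ S := (Substructure.subset_closure ha : a ∈ C)
  refine ⟨e ⟨a, haS⟩, ?_⟩
  change ((e.symm (e ⟨a, haS⟩) : S) : M) = a
  rw [e.symm_apply_apply]

theorem ElementaryEmbedding.exists_factor {L : Language.{u, v}} {A B C : Type*} [L.Structure A]
    [L.Structure B] [L.Structure C] (g : A ↪ₑ[L] C) (h : B ↪ₑ[L] C)
    (hgh : Set.range g ⊆ Set.range h) : ∃ k : A ↪ₑ[L] B, h.comp k = g := by
  choose k hk using fun a => hgh ⟨a, rfl⟩
  refine ⟨⟨k, fun n φ x => ?_⟩, ElementaryEmbedding.ext hk⟩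
  rw [← g.map_formula, ← h.map_formula]
  have : (h ∘ k ∘ x) = g ∘ x := funext fun i => hk _
  rw [this]

variable {L : Language.{u, v}} {T : L.Theory}

/-- `Theory.IsNIP` speaks of models in one universe only. A shattered sequence and its parameters
involve finitely many elements, which lie in an elementary submodel from that universe. -/
theorem Theory.IsNIP.exists_bound (hT : T.IsNIP) {X Y : Type} [Finite X] [Finite Y]
    (φ : L.Formula (X ⊕ Y)) : ∃ n : ℕ, ∀ (M : Type w) [L.Structure M] [Nonempty M] [M ⊨ T],
      ¬ ∃ (a : Fin n → X → M) (b : Set (Fin n) → Y → M),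
        ∀ (i : Fin n) (S : Set (Fin n)), φ.Realize (Sum.elim (a i) (b S)) ↔ i ∈ S := by
  obtain ⟨k, ⟨eX⟩⟩ := Finite.exists_equiv_fin X
  obtain ⟨m, ⟨eY⟩⟩ := Finite.exists_equiv_fin Y
  obtain ⟨n, hn⟩ := hT k m (φ.relabel (Sum.map eX eY))
  refine ⟨n, ?_⟩
  rintro M _ _ hM ⟨a, b, hab⟩
  let s : Set M := Set.range (fun p : Fin n × X => a p.1 p.2) ∪
    Set.range (fun p : Set (Fin n) × Y => b p.1 p.2)
  have hs : s.Finite := (Set.finite_range _).union (Set.finite_range _)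
  have : Small.{max u v} s := by
    have := hs.to_subtype
    exact Countable.toSmall _
  obtain ⟨M₀, _, f, hf⟩ := exists_small_elementaryEmbedding (L := L) s
  choose a' ha' using fun i x => hf (Or.inl ⟨(i, x), rfl⟩ : a i x ∈ s)
  choose b' hb' using fun i x => hf (Or.inr ⟨(i, x), rfl⟩ : b i x ∈ s)
  have hM₀ : M₀ ⊨ T := (f.theory_model_iff T).2 hM
  have : Nonempty M₀ := (f.elementarilyEquivalent.nonempty_iff).2 ‹_›
  have key : ∀ (i : Fin n) (S : Set (Fin n)), (φ.relabel (Sum.map eX eY)).Realize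
      (Sum.elim (a' i ∘ eX.symm) (b' S ∘ eY.symm)) ↔ i ∈ S := by
    intro i S
    have h1 : (a' i ∘ eX.symm) ∘ eX = a' i := by ext; simp
    have h2 : (b' S ∘ eY.symm) ∘ eY = b' S := by ext; simp
    have h3 : f ∘ a' i = a i := funext fun x => ha' i x
    have h4 : f ∘ b' S = b S := funext fun x => hb' S x
    rw [← hab, Formula.realize_relabel, Sum.elim_comp_map, h1, h2, ← f.map_formula,
      Sum.comp_elim, h3, h4]
  exact hn (ModelType.of T M₀) ⟨fun i => a' i ∘ eX.symm, fun S => b' S ∘ eY.symm, key⟩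

/-- In a distal theory, generically stable measures over models of any size extend uniquely. -/
theorem Theory.IsDistal.uniqueExtension (hT : T.IsDistal) {M : Type w} [L.Structure M]
    [Nonempty M] [hM : M ⊨ T] {X : Type} [Finite X] {μ : KeislerMeasure L M X}
    (hμ : μ.IsGenericallyStable) : KeislerMeasure.UniqueExtension.{u, v, w, w'} μ := by
  intro N _ f ν ν' hν hν'
  ext D
  obtain ⟨k, ψ, c, rfl⟩ := exists_eq_instanceSet D
  -- The small model `M₀` must contain approximating points for every formula and every error `1 /
  -- (q + 1)`, so that the restriction of `μ` is still generically stable. The small `N₀` contains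
  -- the image of `M₀` and the parameters of the one set at which `ν` and `ν'` are compared.
  let I := Σ m : ℕ, L.Formula (X ⊕ Fin m) × ℕ
  choose n a hn ha using fun i : I => hμ i.1 i.2.1 (1 / ((i.2.2 : ℝ) + 1)) (by positivity)
  let s : Set M := Set.range fun p : (Σ i : I, Fin (n i) × X) => a p.1 p.2.1 p.2.2
  obtain ⟨M₀, _, g, hg⟩ := exists_small_elementaryEmbedding (L := L) s
  have : Nonempty N := Nonempty.map f ‹_›
  obtain ⟨N₀, _, h, hh⟩ := exists_small_elementaryEmbedding (L := L)
    (Set.range (f.comp g) ∪ Set.range c)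
  obtain ⟨l, hl⟩ := ElementaryEmbedding.exists_factor (f.comp g) h
    (Set.subset_union_left.trans hh)
  have hM₀ : M₀ ⊨ T := (g.theory_model_iff T).2 hM
  have : Nonempty M₀ := (g.elementarilyEquivalent.nonempty_iff).2 ‹_›
  choose a' ha' using fun i j x => hg ⟨⟨i, j, x⟩, rfl⟩
  choose c' hc' using fun x => hh (Or.inr ⟨x, rfl⟩ : c x ∈ _)
  have hgs : (μ.comap g).IsGenericallyStable := by
    intro m φ ε hε
    obtain ⟨q, hq⟩ := exists_nat_one_div_lt hε
    refine ⟨n ⟨m, φ, q⟩, a' ⟨m, φ, q⟩, hn _, fun b => le_trans ?_ hq.le⟩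
    have h1 := ha ⟨m, φ, q⟩ (g ∘ b)
    rw [← DefinableSet.lift_instanceSet] at h1
    have h2 : ∀ i, φ.Realize (Sum.elim (a ⟨m, φ, q⟩ i) (g ∘ b)) ↔
        φ.Realize (Sum.elim (a' ⟨m, φ, q⟩ i) b) := by
      intro i
      rw [← g.map_formula, Sum.comp_elim]
      have h3 : g ∘ a' ⟨m, φ, q⟩ i = a ⟨m, φ, q⟩ i := funext fun x => ha' _ i x
      rw [h3]
    simp only [h2] at h1
    exact h1
  have hsm := (hT.2 (ModelType.of T M₀) X (μ.comap g) hgs N₀ l).unique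
    (y₁ := ν.comap h) (y₂ := ν'.comap h)
  have hext : ∀ ν : KeislerMeasure L N X, ν.Extends f μ → (ν.comap h).Extends l (μ.comap g) := by
    intro ν hν
    rw [KeislerMeasure.extends_iff] at hν ⊢
    intro D
    change ν.meas ((D.lift l).lift h) = μ.meas (D.lift g)
    rw [← DefinableSet.lift_comp, hl, DefinableSet.lift_comp, hν]
  have heq := hsm (hext ν hν) (hext ν' hν')
  have h1 := congrArg (fun ρ => ρ.meas (instanceSet ψ c')) heq
  change ν.meas ((instanceSet ψ c').lift h) = ν'.meas ((instanceSet ψ c').lift h) at h1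
  rw [DefinableSet.lift_instanceSet] at h1
  have h2 : h ∘ c' = c := funext hc'
  rwa [h2] at h1

/-! ### Vapnik–Chervonenkis approximation. -/

section VC

open Classical in
/-- The proportion of the points of a finite family that lie in a set. -/
noncomputable def average {ι Ω : Type*} [Fintype ι] (a : ι → Ω) (A : Set Ω) : ℝ :=
  (∑ i, if a i ∈ A then (1 : ℝ) else 0) / Fintype.card ι

theorem average_eq {ι Ω : Type*} [Fintype ι] (a : ι → Ω) (A : Set Ω)
    [∀ i, Decidable (a i ∈ A)] :
    average a A = (∑ i, if a i ∈ A then (1 : ℝ) else 0) / Fintype.card ι := by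
  rw [average]
  congr! 3

theorem average_fin {Ω : Type*} {n : ℕ} (a : Fin n → Ω) (A : Set Ω) :
    average a A = (Set.ncard {i | a i ∈ A} : ℝ) / n := by
  classical
  rw [average, Fintype.card_fin, Finset.sum_boole, Set.ncard_eq_toFinset_card']
  simp

theorem average_comp_equiv {ι κ Ω : Type*} [Fintype ι] [Fintype κ] (a : ι → Ω) (e : κ ≃ ι)
    (A : Set Ω) : average (a ∘ e) A = average a A := by
  classical
  rw [average, average, Fintype.card_congr e]
  congr 1
  exact e.sum_comp fun i => if a i ∈ A then (1 : ℝ) else 0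

/-- No sequence of `d` points is shattered by the sets in `𝒮`. -/
def NotShattering {Ω : Type*} (d : ℕ) (𝒮 : Set (Set Ω)) : Prop :=
  ∀ a : Fin d → Ω, ¬ ∀ S : Set (Fin d), ∃ A ∈ 𝒮, ∀ i, a i ∈ A ↔ i ∈ S

open Classical in
/-- The traces of the sets in `𝒮` on a finite family of points. -/
noncomputable def traces {ι Ω : Type*} [Fintype ι] (𝒮 : Set (Set Ω)) (a : ι → Ω) :
    Finset (Finset ι) :=
  Finset.univ.filter fun t => ∃ A ∈ 𝒮, t = Finset.univ.filter fun i => a i ∈ A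

/-- This is the Sauer–Shelah bound, with the sum of binomial coefficients estimated termwise by the
expansion of a `d`-th power. -/
theorem card_traces_le {ι Ω : Type*} [Fintype ι] {d : ℕ} {𝒮 : Set (Set Ω)}
    (h : NotShattering d 𝒮) (a : ι → Ω) :
    (traces 𝒮 a).card ≤ (Fintype.card ι + 1) ^ d := by
  classical
  have hdim : (traces 𝒮 a).vcDim ≤ d := by
    refine Finset.sup_le fun s hs => ?_
    rw [Finset.mem_shatterer] at hs
    by_contra hd
    obtain ⟨t, hts, htd⟩ := Finset.exists_subset_card_eq (not_le.1 hd).le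
    have ht := hs.mono_right hts
    let e : Fin d ≃ t := (t.equivFinOfCardEq htd).symm
    refine h (fun i => a (e i)) fun S => ?_
    obtain ⟨u, hu, htu⟩ := ht (t := (Finset.univ.filter fun i => i ∈ S).image
      fun i => (e i : ι)) (by
        intro x hx
        obtain ⟨i, -, rfl⟩ := Finset.mem_image.1 hx
        exact (e i).2)
    obtain ⟨A, hA, rfl⟩ := (Finset.mem_filter.1 hu).2
    refine ⟨A, hA, fun i => ?_⟩
    have h1 := Finset.ext_iff.1 htu (e i)
    simp only [Finset.mem_inter, Finset.mem_filter, Finset.mem_univ, true_and,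
      Finset.mem_image, (e i).2] at h1
    rw [h1]
    constructor
    · rintro ⟨j, hj, hij⟩
      rwa [← e.injective (Subtype.ext hij)]
    · exact fun hi => ⟨i, hi, rfl⟩
  calc (traces 𝒮 a).card ≤ (traces 𝒮 a).shatterer.card := Finset.card_le_card_shatterer _
    _ ≤ ∑ k ∈ Finset.Iic (traces 𝒮 a).vcDim, (Fintype.card ι).choose k :=
      Finset.card_shatterer_le_sum_vcDim
    _ ≤ ∑ k ∈ Finset.range (d + 1), (Fintype.card ι).choose k := by
      apply Finset.sum_le_sum_of_subset
      intro k hk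
      rw [Finset.mem_Iic] at hk
      rw [Finset.mem_range]
      omega
    _ ≤ ∑ k ∈ Finset.range (d + 1), (Fintype.card ι) ^ k * 1 ^ (d - k) * d.choose k := by
      apply Finset.sum_le_sum
      intro k hk
      rw [one_pow, mul_one]
      refine (Nat.choose_le_pow _ _).trans ?_
      refine Nat.le_mul_of_pos_right _ (Nat.choose_pos ?_)
      rw [Finset.mem_range] at hk
      omega
    _ = (Fintype.card ι + 1) ^ d := (add_pow _ _ _).symm

/-- A Chernoff bound for sums of independent random signs. -/
theorem card_signs_le {k : ℕ} (x : Fin k → ℝ) (hx : ∀ i, |x i| ≤ 1) {e : ℝ}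
    (he : 0 ≤ e) :
    ((Finset.univ.filter fun g : Fin k → Bool =>
      2 * k * e < ∑ i, (if g i then x i else - x i)).card : ℝ) * Real.exp (2 * k * e ^ 2) ≤
        2 ^ k := by
  -- Exponential moments: each factor is `2 cosh (2 * e * x i) ≤ 2 exp (2 * e ^ 2)`, while every
  -- counted choice of signs contributes at least `exp (4 * k * e ^ 2)`.
  have h1 : ∑ g : Fin k → Bool, Real.exp (2 * e * ∑ i, (if g i then x i else - x i)) =
      ∏ i : Fin k, (Real.exp (2 * e * x i) + Real.exp (-(2 * e * x i))) := by
    have h2 : ∀ i : Fin k, Real.exp (2 * e * x i) + Real.exp (-(2 * e * x i)) =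
        ∑ b : Bool, Real.exp (2 * e * if b then x i else - x i) := by
      intro i
      simp
    simp_rw [h2]
    rw [Finset.prod_univ_sum, Fintype.piFinset_univ]
    refine Finset.sum_congr rfl fun g _ => ?_
    rw [Finset.mul_sum, Real.exp_sum]
  have h3 : ∏ i : Fin k, (Real.exp (2 * e * x i) + Real.exp (-(2 * e * x i))) ≤
      2 ^ k * Real.exp (2 * k * e ^ 2) := by
    have : ∀ i ∈ (Finset.univ : Finset (Fin k)),
        Real.exp (2 * e * x i) + Real.exp (-(2 * e * x i)) ≤ 2 * Real.exp (2 * e ^ 2) := by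
      intro i _
      have h4 := Real.cosh_le_exp_half_sq (2 * e * x i)
      rw [Real.cosh_eq] at h4
      have h5 : Real.exp ((2 * e * x i) ^ 2 / 2) ≤ Real.exp (2 * e ^ 2) := by
        apply Real.exp_le_exp.2
        have h6 : (x i) ^ 2 ≤ 1 := (sq_le_one_iff_abs_le_one _).2 (hx i)
        nlinarith [sq_nonneg e]
      linarith
    refine (Finset.prod_le_prod (fun i _ => by positivity) this).trans ?_
    rw [Finset.prod_const, Finset.card_univ, Fintype.card_fin, mul_pow, ← Real.exp_nat_mul]
    apply le_of_eq
    congr 2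
    ring
  have h7 : ((Finset.univ.filter fun g : Fin k → Bool =>
      2 * k * e < ∑ i, (if g i then x i else - x i)).card : ℝ) * Real.exp (4 * k * e ^ 2) ≤
      ∑ g : Fin k → Bool, Real.exp (2 * e * ∑ i, (if g i then x i else - x i)) := by
    rw [← nsmul_eq_mul]
    refine (Finset.card_nsmul_le_sum _ _ _ fun g hg => ?_).trans
      (Finset.sum_le_sum_of_subset_of_nonneg (Finset.filter_subset _ _)
        fun g _ _ => (Real.exp_pos _).le)
    rw [Finset.mem_filter] at hg
    apply Real.exp_le_exp.2
    nlinarith [mul_le_mul_of_nonneg_left hg.2.le he]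
  have h8 : Real.exp (4 * k * e ^ 2) = Real.exp (2 * k * e ^ 2) * Real.exp (2 * k * e ^ 2) := by
    rw [← Real.exp_add]
    congr 1
    ring
  rw [h8, h1, ← mul_assoc] at h7
  exact le_of_mul_le_mul_right (h7.trans h3) (Real.exp_pos _)

/-- One point of each pair `a₀ i`, `a₁ i` is picked by a fair coin. For a fixed trace the two
averages differ by a randomly signed sum of numbers in `{-1, 0, 1}`, divided by `2 * k`. The
Chernoff bound in both directions and the polynomial number of traces leave, by `hk`, a choice that
is good for all traces. -/
theorem exists_transversal {Ω : Type*} {d k : ℕ} {𝒮 : Set (Set Ω)} (h : NotShattering d 𝒮)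
    (a₀ a₁ : Fin k → Ω) {e : ℝ} (he : 0 ≤ e)
    (hk : 2 * (2 * (k : ℝ) + 1) ^ d < Real.exp (2 * k * e ^ 2)) :
    ∃ a : Fin k → Ω, ∀ A ∈ 𝒮, |average (Sum.elim a₀ a₁) A - average a A| ≤ e := by
  classical
  have hk0 : (0 : ℝ) < k := by
    rcases Nat.eq_zero_or_pos k with rfl | hk0
    · norm_num at hk
    · exact_mod_cast hk0
  let 𝒯 := traces 𝒮 (Sum.elim a₀ a₁)
  let x : Finset (Fin k ⊕ Fin k) → Fin k → ℝ := fun t i =>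
    (if Sum.inr i ∈ t then 1 else 0) - (if Sum.inl i ∈ t then 1 else 0)
  have hx : ∀ t i, |x t i| ≤ 1 := by
    intro t i
    simp only [x]
    split_ifs <;> norm_num
  let B : (Fin k → ℝ) → Finset (Fin k → Bool) := fun y => Finset.univ.filter fun g =>
    2 * k * e < ∑ i, (if g i then y i else - y i)
  have hB : ∀ y, (∀ i, |y i| ≤ 1) → ((B y).card : ℝ) ≤ 2 ^ k / Real.exp (2 * k * e ^ 2) := by
    intro y hy
    rw [le_div_iff₀ (Real.exp_pos _)]
    exact card_signs_le y hy he
  have hcard : ((𝒯.biUnion fun t => B (x t) ∪ B (- x t)).card : ℝ) < 2 ^ k := by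
    calc ((𝒯.biUnion fun t => B (x t) ∪ B (- x t)).card : ℝ)
        ≤ ∑ t ∈ 𝒯, ((B (x t) ∪ B (- x t)).card : ℝ) := by
          exact_mod_cast Finset.card_biUnion_le
      _ ≤ ∑ t ∈ 𝒯, 2 * (2 ^ k / Real.exp (2 * k * e ^ 2)) := by
          refine Finset.sum_le_sum fun t _ => ?_
          have h1 : ((B (x t) ∪ B (- x t)).card : ℝ) ≤ (B (x t)).card + (B (- x t)).card := by
            exact_mod_cast Finset.card_union_le _ _
          have h2 := hB (x t) (hx t)
          have h3 := hB (- x t) fun i => by rw [Pi.neg_apply, abs_neg]; exact hx t i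
          linarith
      _ = 𝒯.card * (2 * (2 ^ k / Real.exp (2 * k * e ^ 2))) := by
          rw [Finset.sum_const, nsmul_eq_mul]
      _ ≤ (2 * (k : ℝ) + 1) ^ d * (2 * (2 ^ k / Real.exp (2 * k * e ^ 2))) := by
          refine mul_le_mul_of_nonneg_right ?_ (by positivity)
          have h1 := card_traces_le h (Sum.elim a₀ a₁)
          rw [Fintype.card_sum, Fintype.card_fin, ← two_mul] at h1
          exact_mod_cast h1
      _ < 2 ^ k := by
          rw [← mul_assoc, mul_div_assoc', div_lt_iff₀ (Real.exp_pos _), mul_comm ((2 : ℝ) ^ k)]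
          refine mul_lt_mul_of_pos_right ?_ (by positivity)
          linarith
  obtain ⟨g, hg⟩ : ∃ g, g ∉ 𝒯.biUnion fun t => B (x t) ∪ B (- x t) := by
    by_contra! hall
    have h1 : (𝒯.biUnion fun t => B (x t) ∪ B (- x t)) = Finset.univ :=
      Finset.eq_univ_iff_forall.2 hall
    rw [h1, Finset.card_univ, Fintype.card_fun, Fintype.card_bool, Fintype.card_fin] at hcard
    push_cast at hcard
    exact lt_irrefl _ hcard
  obtain ⟨a, ha⟩ : ∃ a : Fin k → Ω, ∀ i, a i = if g i then a₁ i else a₀ i := ⟨_, fun _ => rfl⟩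
  refine ⟨a, fun A hA => ?_⟩
  let t : Finset (Fin k ⊕ Fin k) := Finset.univ.filter fun i => Sum.elim a₀ a₁ i ∈ A
  have ht : t ∈ 𝒯 := Finset.mem_filter.2 ⟨Finset.mem_univ _, A, hA, rfl⟩
  have hgt : g ∉ B (x t) ∪ B (- x t) := fun h' => hg (Finset.mem_biUnion.2 ⟨t, ht, h'⟩)
  simp only [B, Finset.mem_union, Finset.mem_filter, Finset.mem_univ, true_and, not_or, not_lt,
    Pi.neg_apply, neg_neg] at hgt
  have hneg : ∑ i, (if g i then - x t i else x t i) =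
      - ∑ i, (if g i then x t i else - x t i) := by
    rw [← Finset.sum_neg_distrib]
    refine Finset.sum_congr rfl fun i _ => ?_
    split_ifs <;> simp
  rw [hneg] at hgt
  have hdiff : average (Sum.elim a₀ a₁) A - average a A =
      - (∑ i, (if g i then x t i else - x t i)) / (2 * k) := by
    have h0 : average (Sum.elim a₀ a₁) A = ((∑ i, if a₀ i ∈ A then (1 : ℝ) else 0) +
        ∑ i, if a₁ i ∈ A then (1 : ℝ) else 0) / (2 * k) := by
      rw [average_eq, Fintype.card_sum, Fintype.card_fin, Fintype.sum_sum_type, two_mul,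
        Nat.cast_add]
      rfl
    rw [h0, average_eq, Fintype.card_fin]
    have h1 : ∑ i, (if g i then x t i else - x t i) =
        2 * (∑ i, if a i ∈ A then (1 : ℝ) else 0) -
        ((∑ i, if a₀ i ∈ A then (1 : ℝ) else 0) + ∑ i, if a₁ i ∈ A then (1 : ℝ) else 0) := by
      rw [← Finset.sum_add_distrib, Finset.mul_sum, ← Finset.sum_sub_distrib]
      refine Finset.sum_congr rfl fun i _ => ?_
      simp only [x, t, Finset.mem_filter, Finset.mem_univ, true_and, Sum.elim_inl, Sum.elim_inr, ha]
      cases g i <;> simp <;> split_ifs <;> norm_num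
    rw [h1]
    field_simp
    ring
  rw [hdiff, abs_le]
  constructor
  · rw [le_div_iff₀ (by positivity)]
    linarith [hgt.1]
  · rw [div_le_iff₀ (by positivity)]
    linarith [hgt.2]

/-- Halving a sequence of length `2 ^ (k + 1)` costs `r ^ k`, and the costs add up. -/
theorem exists_average_pow_two {Ω : Type*} {d l : ℕ} {𝒮 : Set (Set Ω)} (h : NotShattering d 𝒮)
    {r : ℝ} (hr : 0 ≤ r)
    (hl : ∀ k ≥ l, 2 * (2 * ((2 ^ k : ℕ) : ℝ) + 1) ^ d <
      Real.exp (2 * ((2 ^ k : ℕ) : ℝ) * (r ^ k) ^ 2)) (j : ℕ) :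
    ∀ a : Fin (2 ^ (l + j)) → Ω, ∃ a' : Fin (2 ^ l) → Ω, ∀ A ∈ 𝒮,
      |average a A - average a' A| ≤ ∑ i ∈ Finset.range j, r ^ (l + i) := by
  induction j with
  | zero => exact fun a => ⟨a, fun A _ => by simp⟩
  | succ j ih =>
    intro a
    have hcard : Fintype.card (Fin (2 ^ (l + j)) ⊕ Fin (2 ^ (l + j))) = 2 ^ (l + (j + 1)) := by
      rw [Fintype.card_sum, Fintype.card_fin]
      ring
    let e := Fintype.equivFinOfCardEq hcard
    obtain ⟨b, hb⟩ := exists_transversal h (a ∘ e ∘ Sum.inl) (a ∘ e ∘ Sum.inr)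
      (pow_nonneg hr (l + j)) (hl (l + j) (Nat.le_add_right _ _))
    obtain ⟨c, hc⟩ := ih b
    refine ⟨c, fun A hA => ?_⟩
    have h1 := hb A hA
    have h2 : Sum.elim (a ∘ e ∘ Sum.inl) (a ∘ e ∘ Sum.inr) = a ∘ e := by
      funext x
      rcases x with x | x <;> rfl
    rw [h2, average_comp_equiv] at h1
    rw [Finset.sum_range_succ]
    have h3 := abs_sub_le (average a A) (average b A) (average c A)
    linarith [hc A hA]

/-- The ratio `9 / 10` is less than 1, so the costs sum to at most `10 * (9 / 10) ^ l`. It also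
exceeds `1 / √2`, so the exponent, equal to `2 * (81 / 50) ^ k`, grows exponentially and beats the
logarithm of the left side, which is linear in `k` up to a constant. -/
theorem exists_pow_two_bound (d : ℕ) {ε : ℝ} (hε : 0 < ε) : ∃ l : ℕ,
    (∀ k ≥ l, 2 * (2 * ((2 ^ k : ℕ) : ℝ) + 1) ^ d <
      Real.exp (2 * ((2 ^ k : ℕ) : ℝ) * ((9 / 10 : ℝ) ^ k) ^ 2)) ∧
    ∀ j, ∑ i ∈ Finset.range j, (9 / 10 : ℝ) ^ (l + i) ≤ ε := by
  have h1 : Filter.Tendsto (fun k : ℕ => (Real.log 2 + d * Real.log 3) *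
      ((k : ℝ) ^ 0 / (81 / 50 : ℝ) ^ k) + d * Real.log 2 * ((k : ℝ) ^ 1 / (81 / 50 : ℝ) ^ k))
      Filter.atTop (nhds ((Real.log 2 + d * Real.log 3) * 0 + d * Real.log 2 * 0)) :=
    ((tendsto_pow_const_div_const_pow_of_one_lt 0 (by norm_num)).const_mul _).add
      ((tendsto_pow_const_div_const_pow_of_one_lt 1 (by norm_num)).const_mul _)
  rw [mul_zero, mul_zero, add_zero] at h1
  have h2 := h1.eventually_lt_const (u := 2) (by norm_num)
  have h3 : Filter.Tendsto (fun k : ℕ => 10 * (9 / 10 : ℝ) ^ k) Filter.atTop (nhds (10 * 0)) :=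
    (tendsto_pow_atTop_nhds_zero_of_lt_one (by norm_num) (by norm_num)).const_mul _
  rw [mul_zero] at h3
  have h4 := h3.eventually_lt_const hε
  obtain ⟨l₁, hl₁⟩ := Filter.eventually_atTop.1 h2
  obtain ⟨l₂, hl₂⟩ := Filter.eventually_atTop.1 h4
  refine ⟨max l₁ l₂, fun k hk => ?_, fun j => ?_⟩
  · have h5 := hl₁ k ((le_max_left _ _).trans hk)
    have hpos : (0 : ℝ) < (81 / 50 : ℝ) ^ k := by positivity
    have h6 : Real.log 2 + d * Real.log 3 + d * (k * Real.log 2) < 2 * (81 / 50 : ℝ) ^ k := by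
      have h7 := mul_lt_mul_of_pos_right h5 hpos
      refine lt_of_eq_of_lt ?_ h7
      field_simp
    have h8 : 2 * ((2 ^ k : ℕ) : ℝ) * ((9 / 10 : ℝ) ^ k) ^ 2 = 2 * (81 / 50 : ℝ) ^ k := by
      push_cast
      rw [← pow_mul, mul_comm k 2, pow_mul, mul_assoc, ← mul_pow]
      norm_num
    rw [h8]
    have h9 : (1 : ℝ) ≤ 2 ^ k := one_le_pow₀ (by norm_num)
    have h10 : 2 * (2 * ((2 ^ k : ℕ) : ℝ) + 1) ^ d ≤ 2 * (3 * 2 ^ k) ^ d := by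
      push_cast
      gcongr
      linarith
    have h11 : (2 : ℝ) * (3 * 2 ^ k) ^ d =
        Real.exp (Real.log 2 + d * Real.log 3 + d * (k * Real.log 2)) := by
      rw [Real.exp_add, Real.exp_add, Real.exp_log (by norm_num), Real.exp_nat_mul,
        Real.exp_log (by norm_num), Real.exp_nat_mul, Real.exp_nat_mul,
        Real.exp_log (by norm_num), mul_pow, mul_assoc]
    rw [h11] at h10
    exact h10.trans_lt (Real.exp_lt_exp.2 h6)
  · have h5 := hl₂ (max l₁ l₂) (le_max_right _ _)
    refine le_trans ?_ h5.le
    simp_rw [pow_add]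
    rw [← Finset.mul_sum, mul_comm (10 : ℝ)]
    refine mul_le_mul_of_nonneg_left ?_ (by positivity)
    have h6 := geom_sum_eq (x := (9 / 10 : ℝ)) (by norm_num) j
    rw [h6]
    have : (0 : ℝ) ≤ (9 / 10 : ℝ) ^ j := by positivity
    rw [div_le_iff_of_neg (by norm_num)]
    linarith

/-- The approximation theorem of Vapnik and Chervonenkis: a finite family of points can be replaced
by one of bounded length without changing much the averages over the sets in a VC class. -/
theorem exists_average_near_average (d : ℕ) {ε : ℝ} (hε : 0 < ε) : ∃ N : ℕ, 0 < N ∧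
    ∀ {Ω : Type w} {𝒮 : Set (Set Ω)}, NotShattering d 𝒮 → ∀ {n : ℕ}, 0 < n → ∀ a : Fin n → Ω,
      ∃ a' : Fin N → Ω, ∀ A ∈ 𝒮, |average a A - average a' A| ≤ ε := by
  classical
  obtain ⟨l, hl, hsum⟩ := exists_pow_two_bound d (half_pos hε)
  refine ⟨2 ^ l, by positivity, fun {Ω 𝒮} h n hn a => ?_⟩
  let p : Ω →₀ ℝ := ∑ i, Finsupp.single (a i) (1 / (n : ℝ))
  have hmass : ∀ A, pointMass p A = average a A := by
    intro A
    have h1 : ∀ s : Finset (Fin n), pointMass (∑ i ∈ s, Finsupp.single (a i) (1 / (n : ℝ))) A =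
        ∑ i ∈ s, if a i ∈ A then 1 / (n : ℝ) else 0 := by
      intro s
      induction s using Finset.induction_on with
      | empty => simp [pointMass_zero]
      | insert i s hi ih =>
        rw [Finset.sum_insert hi, Finset.sum_insert hi, pointMass_add, ih, pointMass_single]
    rw [h1, average, Fintype.card_fin, Finset.sum_div]
    refine Finset.sum_congr rfl fun i _ => ?_
    split_ifs <;> simp
  have hp : ∀ x, 0 ≤ p x := by
    intro x
    rw [Finsupp.finsetSum_apply]
    refine Finset.sum_nonneg fun i _ => ?_
    rw [Finsupp.single_apply]
    split_ifs
    · positivity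
    · exact le_rfl
  have hp1 : pointMass p Set.univ = 1 := by
    rw [hmass, average]
    simp [hn.ne']
  -- The family is first replaced by one whose length is a power of two. The exponent depends on
  -- `a`, but halving brings the length back to `2 ^ l`.
  obtain ⟨j, hj⟩ := pow_unbounded_of_one_lt ((p.support.card : ℝ) / (ε / 2))
    (one_lt_two : (1 : ℝ) < 2)
  rw [div_lt_iff₀ (half_pos hε)] at hj
  obtain ⟨b, hb⟩ := exists_average_near_pointMass p hp hp1 (half_pos hε) (n := 2 ^ (l + j)) (by
    refine hj.trans_le (mul_le_mul_of_nonneg_right ?_ (half_pos hε).le)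
    push_cast
    exact pow_le_pow_right₀ one_le_two (Nat.le_add_left _ _))
  obtain ⟨c, hc⟩ := exists_average_pow_two h (by norm_num) hl j b
  refine ⟨c, fun A hA => ?_⟩
  have h1 := hb A
  rw [hmass, ← average_fin] at h1
  have h2 := abs_sub_le (average a A) (average b A) (average c A)
  linarith [hc A hA, hsum j]

end VC

/-- In an NIP theory the number of points in the approximations of a generically stable measure
depends only on the formula and on the error. -/
theorem Theory.IsNIP.exists_uniform_average {L : Language.{u, v}} {T : L.Theory} (hT : T.IsNIP)
    {X Y : Type} [Finite X] [Finite Y] (φ : L.Formula (X ⊕ Y)) {ε : ℝ} (hε : 0 < ε) :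
    ∃ N : ℕ, 0 < N ∧ ∀ (M : Type w) [L.Structure M] [Nonempty M] [M ⊨ T] {n : ℕ}, 0 < n →
      ∀ a : Fin n → X → M, ∃ a' : Fin N → X → M, ∀ b : Y → M,
        |(Set.ncard {i | φ.Realize (Sum.elim (a i) b)} : ℝ) / n -
          (Set.ncard {i | φ.Realize (Sum.elim (a' i) b)} : ℝ) / N| ≤ ε := by
  obtain ⟨d, hd⟩ := hT.exists_bound φ
  obtain ⟨N, hN, h⟩ := exists_average_near_average d hε
  refine ⟨N, hN, fun M _ _ _ n hn a => ?_⟩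
  obtain ⟨a', ha'⟩ := h (Ω := X → M)
    (𝒮 := {A | ∃ b : Y → M, A = {x | φ.Realize (Sum.elim x b)}}) (by
      intro x hx
      choose A hA hxA using hx
      choose b hb using hA
      refine hd M ⟨x, b, fun i S => ?_⟩
      rw [← hxA S i, hb S]
      rfl) hn a
  refine ⟨a', fun b => ?_⟩
  have h1 := ha' _ ⟨b, rfl⟩
  rw [average_fin, average_fin] at h1
  exact h1

/-! ### Definable sets in ultraproducts. -/

section Ultraproduct

variable {L : Language.{u, v}} {I : Type w'} {U : Ultrafilter I} {M : I → Type w}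
  [∀ i, L.Structure (M i)] {X Y : Type}

/-- The tuple of elements of the ultraproduct given by tuples in the factors. -/
def Ultraproduct.tuple (U : Ultrafilter I) (x : ∀ i, X → M i) :
    X → (U : Filter I).Product M :=
  fun j => ((fun i => x i j : ∀ i, M i) : (U : Filter I).Product M)

theorem Ultraproduct.exists_tuple (y : X → (U : Filter I).Product M) :
    ∃ x : ∀ i, X → M i, Ultraproduct.tuple U x = y := by
  choose x hx using fun j => Quotient.exists_rep (y j)
  exact ⟨fun i j => x j i, funext hx⟩

theorem Ultraproduct.elim_tuple (x : ∀ i, X → M i) (y : ∀ i, Y → M i) :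
    Sum.elim (Ultraproduct.tuple U x) (Ultraproduct.tuple U y) =
      Ultraproduct.tuple U fun i => Sum.elim (x i) (y i) := by
  funext z
  rcases z with z | z <;> rfl

/-- The definable set `D` in the ultraproduct is the limit of the definable sets `E i`. -/
def DefinableSet.IsLimit (D : L.DefinableSet (Set.univ : Set ((U : Filter I).Product M)) X)
    (E : ∀ i, L.DefinableSet (Set.univ : Set (M i)) X) : Prop :=
  ∀ x : ∀ i, X → M i, Ultraproduct.tuple U x ∈ D ↔ ∀ᶠ i in U, x i ∈ E i

namespace DefinableSet

variable {D D' : L.DefinableSet (Set.univ : Set ((U : Filter I).Product M)) X}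
  {E E' : ∀ i, L.DefinableSet (Set.univ : Set (M i)) X}

theorem IsLimit.sup (h : D.IsLimit E) (h' : D'.IsLimit E') :
    (D ⊔ D').IsLimit fun i => E i ⊔ E' i := by
  intro x
  simp only [mem_sup, Ultrafilter.eventually_or, h x, h' x]

theorem IsLimit.inf (h : D.IsLimit E) (h' : D'.IsLimit E') :
    (D ⊓ D').IsLimit fun i => E i ⊓ E' i := by
  intro x
  simp only [mem_inf, Filter.eventually_and, h x, h' x]

theorem isLimit_top : IsLimit (⊤ : L.DefinableSet (Set.univ : Set ((U : Filter I).Product M)) X)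
    fun _ => ⊤ := by
  intro x
  simp

theorem isLimit_bot : IsLimit (⊥ : L.DefinableSet (Set.univ : Set ((U : Filter I).Product M)) X)
    fun _ => ⊥ := by
  intro x
  simpa using U.neBot.ne

theorem isLimit_cylinder {d : ℕ} {n : Fin d → ℕ} {j : Fin d}
    {D : L.DefinableSet (Set.univ : Set ((U : Filter I).Product M)) (Fin (n j))}
    {E : ∀ i, L.DefinableSet (Set.univ : Set (M i)) (Fin (n j))} (h : D.IsLimit E) :
    (cylinder j D).IsLimit fun i => cylinder j (E i) :=
  fun x => h fun i k => x i ⟨j, k⟩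

end DefinableSet

variable [∀ i, Nonempty (M i)]

theorem Ultraproduct.realize_tuple (φ : L.Formula X) (x : ∀ i, X → M i) :
    φ.Realize (Ultraproduct.tuple U x) ↔ ∀ᶠ i in U, φ.Realize (x i) :=
  Ultraproduct.realize_formula_cast φ fun j i => x i j

theorem Ultraproduct.models {T : L.Theory} (h : ∀ i, M i ⊨ T) :
    (U : Filter I).Product M ⊨ T := by
  rw [Theory.model_iff]
  intro φ hφ
  rw [Ultraproduct.sentence_realize]
  exact Filter.Eventually.of_forall fun i => (Theory.model_iff T).1 (h i) φ hφ

/-- The diagonal embedding into an ultrapower. -/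
def Ultraproduct.diagonal (U : Ultrafilter I) (M : Type w) [L.Structure M] [Nonempty M] :
    M ↪ₑ[L] (U : Filter I).Product fun _ => M where
  toFun a := ((fun _ => a : I → M) : (U : Filter I).Product fun _ => M)
  map_formula' n φ x := by
    have h := Ultraproduct.realize_tuple (U := U) φ fun _ => x
    rw [Filter.eventually_const] at h
    exact h

namespace DefinableSet

theorem isLimit_instanceSet (φ : L.Formula (X ⊕ Y)) (b : ∀ i, Y → M i) :
    IsLimit (instanceSet φ (Ultraproduct.tuple U b)) fun i => instanceSet φ (b i) := by
  intro x
  rw [mem_instanceSet, Ultraproduct.elim_tuple, Ultraproduct.realize_tuple]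
  rfl

theorem exists_isLimit (D : L.DefinableSet (Set.univ : Set ((U : Filter I).Product M)) X) :
    ∃ E, D.IsLimit E := by
  obtain ⟨m, φ, b, rfl⟩ := exists_eq_instanceSet D
  obtain ⟨b, rfl⟩ := Ultraproduct.exists_tuple b
  exact ⟨_, isLimit_instanceSet φ b⟩

variable {D D' : L.DefinableSet (Set.univ : Set ((U : Filter I).Product M)) X}
  {E E' : ∀ i, L.DefinableSet (Set.univ : Set (M i)) X}

theorem IsLimit.le_iff (h : D.IsLimit E) (h' : D'.IsLimit E') :
    D ≤ D' ↔ ∀ᶠ i in U, E i ≤ E' i := by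
  constructor
  · intro hle
    by_contra hne
    rw [← Ultrafilter.eventually_not] at hne
    have hE : ∀ i, ∃ x : X → M i, ¬ E i ≤ E' i → x ∈ E i ∧ x ∉ E' i := by
      intro i
      by_cases hi : E i ≤ E' i
      · exact ⟨fun _ => Classical.arbitrary _, fun h => (h hi).elim⟩
      · obtain ⟨x, hx, hx'⟩ := Set.not_subset.1 hi
        exact ⟨x, fun _ => ⟨hx, hx'⟩⟩
    choose x hx using hE
    have h1 := hle ((h x).2 (hne.mono fun i hi => (hx i hi).1))
    obtain ⟨i, hi, hi'⟩ := (((h' x).1 h1).and hne).exists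
    exact (hx i hi').2 hi
  · intro hle y hy
    obtain ⟨x, rfl⟩ := Ultraproduct.exists_tuple y
    exact (h' x).2 (((h x).1 hy).mp (hle.mono fun i hi hx => hi hx))

theorem IsLimit.eventually_eq (h : D.IsLimit E) (h' : D.IsLimit E') :
    ∀ᶠ i in U, E i = E' i :=
  ((h.le_iff h').1 le_rfl).mp (((h'.le_iff h).1 le_rfl).mono fun _ h1 h2 => le_antisymm h2 h1)

end DefinableSet

end Ultraproduct

section Box

variable {L : Language.{u, v}} {M : Type w} [L.Structure M] {d : ℕ} {n : Fin d → ℕ}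

theorem mem_cylinder {i : Fin d} {A : L.DefinableSet (Set.univ : Set M) (Fin (n i))}
    {x : (Σ i : Fin d, Fin (n i)) → M} : x ∈ cylinder i A ↔ (fun j => x ⟨i, j⟩) ∈ A := Iff.rfl

theorem DefinableSet.mem_finset_inf {X ι : Type*} (s : Finset ι)
    (D : ι → L.DefinableSet (Set.univ : Set M) X) {x : X → M} :
    x ∈ s.inf D ↔ ∀ i ∈ s, x ∈ D i := by
  classical
  induction s using Finset.induction_on with
  | empty => simp
  | insert i s hi ih => simp [ih]

theorem mem_box {A : ∀ i : Fin d, L.DefinableSet (Set.univ : Set M) (Fin (n i))}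
    {x : (Σ i : Fin d, Fin (n i)) → M} : x ∈ box A ↔ ∀ i, (fun j => x ⟨i, j⟩) ∈ A i := by
  rw [box, DefinableSet.mem_finset_inf]
  simp [mem_cylinder]

end Box

/-! ### Limits of measures in ultraproducts. -/

section UltraproductMeasure

variable {L : Language.{u, v}} {I : Type w'} {U : Ultrafilter I} {M : I → Type w}
  [∀ i, L.Structure (M i)] {X : Type}

theorem DefinableSet.isLimit_box {d : ℕ} {n : Fin d → ℕ}
    {A : ∀ j, L.DefinableSet (Set.univ : Set ((U : Filter I).Product M)) (Fin (n j))}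
    {B : ∀ i j, L.DefinableSet (Set.univ : Set (M i)) (Fin (n j))}
    (h : ∀ j, (A j).IsLimit fun i => B i j) : (box A).IsLimit fun i => box (B i) := by
  intro x
  simp only [mem_box]
  rw [Filter.eventually_all]
  exact forall_congr' fun j => h j fun i k => x i ⟨j, k⟩

variable [∀ i, Nonempty (M i)]

namespace KeislerMeasure

theorem exists_tendsto_meas (μ : ∀ i, KeislerMeasure L (M i) X)
    (D : L.DefinableSet (Set.univ : Set ((U : Filter I).Product M)) X) :
    ∃ r, ∀ E, D.IsLimit E → Filter.Tendsto (fun i => (μ i).meas (E i)) U (nhds r) := by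
  obtain ⟨E, hE⟩ := D.exists_isLimit
  obtain ⟨r, hr⟩ := exists_tendsto_ultrafilter U (f := fun i => (μ i).meas (E i))
    fun i => ⟨(μ i).nonneg _, (μ i).meas_le_one _⟩
  refine ⟨r, fun E' hE' => hr.congr' ?_⟩
  exact (hE.eventually_eq hE').mono fun i hi => by simp only [hi]

/-- The limit of measures over the factors of an ultraproduct. -/
noncomputable def ultraproduct (U : Ultrafilter I) (μ : ∀ i, KeislerMeasure L (M i) X) :
    KeislerMeasure L ((U : Filter I).Product M) X where
  meas D := (exists_tendsto_meas μ D).choose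
  nonneg D := by
    obtain ⟨E, hE⟩ := D.exists_isLimit
    exact ge_of_tendsto' ((exists_tendsto_meas μ D).choose_spec E hE) fun i => (μ i).nonneg _
  meas_top := by
    refine tendsto_nhds_unique ((exists_tendsto_meas μ ⊤).choose_spec _ DefinableSet.isLimit_top)
      (tendsto_const_nhds.congr fun i => ?_)
    rw [(μ i).meas_top]
  meas_sup := by
    intro D D' hD
    obtain ⟨E, hE⟩ := D.exists_isLimit
    obtain ⟨E', hE'⟩ := D'.exists_isLimit
    refine tendsto_nhds_unique ((exists_tendsto_meas μ (D ⊔ D')).choose_spec _ (hE.sup hE'))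
      ((((exists_tendsto_meas μ D).choose_spec _ hE).add
        ((exists_tendsto_meas μ D').choose_spec _ hE')).congr' ?_)
    have h := hE.inf hE'
    rw [disjoint_iff.1 hD] at h
    filter_upwards [h.eventually_eq DefinableSet.isLimit_bot] with i hi
    exact ((μ i).meas_sup _ _ (disjoint_iff.2 hi)).symm

theorem tendsto_ultraproduct (μ : ∀ i, KeislerMeasure L (M i) X)
    {D : L.DefinableSet (Set.univ : Set ((U : Filter I).Product M)) X}
    {E : ∀ i, L.DefinableSet (Set.univ : Set (M i)) X} (h : D.IsLimit E) :
    Filter.Tendsto (fun i => (μ i).meas (E i)) U (nhds ((ultraproduct U μ).meas D)) :=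
  (exists_tendsto_meas μ D).choose_spec E h

/-- The length `N` has to be the same in all factors, for only then do the approximating points
combine into `N` points of the ultraproduct. -/
theorem IsGenericallyStable.ultraproduct {T : L.Theory} (hT : T.IsNIP) [Finite X]
    (hM : ∀ i, M i ⊨ T) {μ : ∀ i, KeislerMeasure L (M i) X}
    (hμ : ∀ i, (μ i).IsGenericallyStable) :
    (KeislerMeasure.ultraproduct U μ).IsGenericallyStable := by
  intro m φ ε hε
  obtain ⟨N, hN, hav⟩ := hT.exists_uniform_average φ (half_pos hε)
  have h : ∀ i, ∃ a : Fin N → X → M i, ∀ b : Fin m → M i, |(μ i).meas (instanceSet φ b) -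
      (Set.ncard {j | φ.Realize (Sum.elim (a j) b)} : ℝ) / N| ≤ ε := by
    intro i
    obtain ⟨k, a, hk, ha⟩ := hμ i m φ (ε / 2) (half_pos hε)
    obtain ⟨a', ha'⟩ := hav (M i) hk a
    refine ⟨a', fun b => ?_⟩
    have h1 := abs_sub_le ((μ i).meas (instanceSet φ b))
      ((Set.ncard {i | φ.Realize (Sum.elim (a i) b)} : ℝ) / k)
      ((Set.ncard {i | φ.Realize (Sum.elim (a' i) b)} : ℝ) / N)
    linarith [ha b, ha' b]
  choose a ha using h
  refine ⟨N, fun j => Ultraproduct.tuple U fun i => a i j, hN, fun b => ?_⟩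
  obtain ⟨b, rfl⟩ := Ultraproduct.exists_tuple b
  have h1 := tendsto_ultraproduct μ (DefinableSet.isLimit_instanceSet (U := U) φ b)
  have h2 : ∀ᶠ i in U, ∀ j, φ.Realize (Sum.elim (Ultraproduct.tuple U fun i => a i j)
      (Ultraproduct.tuple U b)) ↔ φ.Realize (Sum.elim (a i j) (b i)) := by
    rw [Filter.eventually_all]
    intro j
    simp only [Ultraproduct.elim_tuple, Ultraproduct.realize_tuple]
    by_cases hj : ∀ᶠ i in U, φ.Realize (Sum.elim (a i j) (b i))
    · exact hj.mono fun i hi => iff_of_true hj hi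
    · exact (Ultrafilter.eventually_not.2 hj).mono fun i hi => iff_of_false hj hi
  refine le_of_tendsto (h1.sub_const _).abs ?_
  filter_upwards [h2] with i hi
  simp only [hi]
  exact ha i (b i)

theorem IsProduct.ultraproduct {d : ℕ} {n : Fin d → ℕ}
    {ω : ∀ i, KeislerMeasure L (M i) (Σ j : Fin d, Fin (n j))} (h : ∀ i, (ω i).IsProduct) :
    (KeislerMeasure.ultraproduct U ω).IsProduct := by
  intro A
  choose B hB using fun j => (A j).exists_isLimit
  refine tendsto_nhds_unique (tendsto_ultraproduct ω
    (DefinableSet.isLimit_box (B := fun i j => B j i) hB)) ?_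
  simp only [fun i => h i fun j => B j i]
  exact tendsto_finsetProd _ fun j _ =>
    tendsto_ultraproduct ω (DefinableSet.isLimit_cylinder (hB j))

end KeislerMeasure

end UltraproductMeasure

/-! ### Consequences of unique extension. -/

theorem DefinableSet.isLimit_lift_diagonal {L : Language.{u, v}} {M : Type w} [L.Structure M]
    [Nonempty M] {X : Type} [Finite X] {I : Type w'} (U : Ultrafilter I)
    (D : L.DefinableSet (Set.univ : Set M) X) :
    (D.lift (Ultraproduct.diagonal U M)).IsLimit fun _ => D := by
  obtain ⟨m, φ, b, rfl⟩ := exists_eq_instanceSet D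
  rw [lift_instanceSet]
  exact isLimit_instanceSet φ fun _ => b

namespace KeislerMeasure

theorem IsSmooth.uniqueExtension {L : Language.{u, v}} {M : Type w} [L.Structure M] {X : Type}
    {μ : KeislerMeasure L M X} (hμ : μ.IsSmooth) : UniqueExtension.{u, v, w, max u v w} μ :=
  fun N _ f _ _ hν hν' => (hμ N f).unique hν hν'

variable {L : Language.{u, v}} {M : Type w} [L.Structure M] {X Y : Type} [Finite X]
  {μ : KeislerMeasure L M X}

/-- If every finite set `F` of pairs misses some parameter `b F`, the class of `b` defines a set in
an ultrapower. A sandwich of that set works at `b F` for almost all `F`, including some `F` to which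
it belongs. -/
theorem UniqueExtension.exists_cutting [Nonempty M]
    (hμ : UniqueExtension.{u, v, w, max w w'} μ)
    (φ : L.Formula (X ⊕ Y)) {ε : ℝ} (hε : 0 < ε) :
    ∃ F : Finset (L.DefinableSet (Set.univ : Set M) X × L.DefinableSet (Set.univ : Set M) X),
      (∀ p ∈ F, μ.meas p.2 - μ.meas p.1 < ε) ∧
      ∀ b : Y → M, ∃ p ∈ F, p.1 ≤ instanceSet φ b ∧ instanceSet φ b ≤ p.2 := by
  classical
  let P := L.DefinableSet (Set.univ : Set M) X × L.DefinableSet (Set.univ : Set M) X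
  by_contra hne
  have h : ∀ F : Finset P, ∃ b : Y → M, ∀ p ∈ F, μ.meas p.2 - μ.meas p.1 < ε →
      ¬ (p.1 ≤ instanceSet φ b ∧ instanceSet φ b ≤ p.2) := by
    intro F
    by_contra! hF
    refine hne ⟨F.filter fun p => μ.meas p.2 - μ.meas p.1 < ε,
      fun p hp => (Finset.mem_filter.1 hp).2, fun b => ?_⟩
    obtain ⟨p, hpF, hp, h⟩ := hF b
    exact ⟨p, Finset.mem_filter.2 ⟨hpF, hp⟩, h⟩
  choose b hb using h
  -- `ULift` puts the ultrapower into the universe where extensions are assumed unique.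
  let U : Ultrafilter (ULift.{w'} (Finset P)) :=
    (Ultrafilter.of (Filter.atTop : Filter (Finset P))).map ULift.up
  obtain ⟨θ₀, θ₁, h₀, h₁, h⟩ := hμ.exists_sandwich (Ultraproduct.diagonal U M)
    (instanceSet φ (Ultraproduct.tuple U fun F => b F.down)) hε
  have hφ := DefinableSet.isLimit_instanceSet (U := U) φ fun F => b F.down
  have h₂ := ((DefinableSet.isLimit_lift_diagonal U θ₀).le_iff hφ).1 h₀
  have h₃ := (hφ.le_iff (DefinableSet.isLimit_lift_diagonal U θ₁)).1 h₁
  have h₄ : ∀ᶠ F in (U : Filter (ULift.{w'} (Finset P))), (θ₀, θ₁) ∈ F.down := by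
    change ∀ᶠ F in (Ultrafilter.of (Filter.atTop : Filter (Finset P)) : Filter (Finset P)),
      (θ₀, θ₁) ∈ F
    refine Filter.Eventually.filter_mono (Ultrafilter.of_le _) ?_
    filter_upwards [Filter.mem_atTop {(θ₀, θ₁)}] with F hF
    exact hF (Finset.mem_singleton_self _)
  obtain ⟨F, h₅, h₆, h₇⟩ := (h₂.and (h₃.and h₄)).exists
  exact hb F.down _ h₇ h ⟨h₅, h₆⟩

/-- A sequence that approximates `μ` on the finitely many sets of a cutting approximates it on all
instances, by monotonicity. -/
theorem UniqueExtension.isGenericallyStable [Nonempty M]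
    (hμ : UniqueExtension.{u, v, w, max w w'} μ) : μ.IsGenericallyStable := by
  classical
  intro m φ ε hε
  obtain ⟨F, hF, hφ⟩ := hμ.exists_cutting φ (half_pos hε)
  obtain ⟨n, a, hn, ha⟩ := μ.exists_average (F.image Prod.fst ∪ F.image Prod.snd) (half_pos hε)
  refine ⟨n, a, hn, fun b => ?_⟩
  obtain ⟨p, hp, h₀, h₁⟩ := hφ b
  have hn' : (0 : ℝ) < n := by exact_mod_cast hn
  have hmono : ∀ {D E : L.DefinableSet (Set.univ : Set M) X}, D ≤ E →
      (Set.ncard {i | a i ∈ D} : ℝ) / n ≤ (Set.ncard {i | a i ∈ E} : ℝ) / n := by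
    intro D E hDE
    have h : Set.ncard {i | a i ∈ D} ≤ Set.ncard {i | a i ∈ E} :=
      Set.ncard_le_ncard (fun i hi => hDE hi) (Set.toFinite _)
    gcongr
  have h2 := ha p.1 (Finset.mem_union_left _ (Finset.mem_image_of_mem _ hp))
  have h3 := ha p.2 (Finset.mem_union_right _ (Finset.mem_image_of_mem _ hp))
  have h4 := hF p hp
  have h5 := hmono h₀
  have h6 := hmono h₁
  have h7 := μ.meas_mono h₀
  have h8 := μ.meas_mono h₁
  change |_ - (Set.ncard {i | a i ∈ instanceSet φ b} : ℝ) / n| ≤ ε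
  rw [abs_le] at h2 h3 ⊢
  constructor <;> linarith [h2.1, h2.2, h3.1, h3.2]

end KeislerMeasure

/-- Over models of a distal theory the generically stable measures are the smooth ones. -/
theorem Theory.IsDistal.isGenericallyStable_iff_isSmooth {L : Language.{u, v}} {T : L.Theory}
    (hT : T.IsDistal) {M : Type w} [L.Structure M] [Nonempty M] [M ⊨ T] {X : Type} [Finite X]
    (μ : KeislerMeasure L M X) : μ.IsGenericallyStable ↔ μ.IsSmooth := by
  constructor
  · intro hμ N _ f
    obtain ⟨ν, hν, -⟩ := μ.exists_extends f ⊥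
    exact ⟨ν, hν, fun ν' hν' => hT.uniqueExtension hμ N f ν' ν hν' hν⟩
  · intro hμ
    exact KeislerMeasure.UniqueExtension.isGenericallyStable.{u, v, w, max u v}
      hμ.uniqueExtension

/-! ### Product measures and boxes. -/

/-- A finite cover can be made disjoint inside any class that is closed under differences. -/
theorem exists_pairwiseDisjoint_sup_eq {B ι : Type*} [BooleanAlgebra B] {P : B → Prop}
    (hP : ∀ a b, P a → P b → P (a \ b)) {ψ : ι → B} (hψ : ∀ i, P (ψ i)) (F : Finset ι) :
    ∃ χ : ι → B, (∀ i, P (χ i)) ∧ (∀ i, χ i ≤ ψ i) ∧ (F : Set ι).PairwiseDisjoint χ ∧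
      F.sup χ = F.sup ψ := by
  classical
  induction F using Finset.induction_on with
  | empty => exact ⟨ψ, hψ, fun _ => le_rfl, by simp, rfl⟩
  | insert a F ha ih =>
    obtain ⟨χ, h1, h2, h3, h4⟩ := ih
    refine ⟨fun i => if i = a then ψ a else χ i \ ψ a, fun i => ?_, fun i => ?_, ?_, ?_⟩
    · dsimp only
      split_ifs
      · exact hψ a
      · exact hP _ _ (h1 i) (hψ a)
    · dsimp only
      split_ifs with h
      · rw [h]
      · exact sdiff_le.trans (h2 i)
    · intro i hi j hj hij
      simp only [Finset.coe_insert, Set.mem_insert_iff, Finset.mem_coe] at hi hj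
      dsimp only [Function.onFun]
      split_ifs with h5 h6 h6
      · exact (hij (h5.trans h6.symm)).elim
      · exact disjoint_sdiff_self_right
      · exact disjoint_sdiff_self_left
      · exact (h3 (hi.resolve_left h5) (hj.resolve_left h6) hij).mono sdiff_le sdiff_le
    · rw [Finset.sup_insert, Finset.sup_insert, if_pos rfl, ← h4]
      have h5 : F.sup (fun i => if i = a then ψ a else χ i \ ψ a) = F.sup fun i => χ i \ ψ a := by
        refine Finset.sup_congr rfl fun i hi => ?_
        rw [if_neg]
        rintro rfl
        exact ha hi
      rw [h5, Finset.sup_sdiff_right, sup_sdiff_self_right]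

variable {L : Language.{u, v}} {M : Type w} [L.Structure M]

theorem exists_mem_iff_le_instanceSet {X Y Z : Type} [Finite X] (φ : L.Formula (X ⊕ (Z ⊕ Y)))
    (b : Y → M) (θ : L.DefinableSet (Set.univ : Set M) X) :
    ∃ ψ : L.DefinableSet (Set.univ : Set M) Z, ∀ z,
      z ∈ ψ ↔ θ ≤ instanceSet φ (Sum.elim z b) := by
  obtain ⟨m, χ, c, rfl⟩ := exists_eq_instanceSet θ
  refine ⟨instanceSet ((instanceLE χ φ).relabel (Sum.elim (Sum.inr ∘ Sum.inl)
    (Sum.elim Sum.inl (Sum.inr ∘ Sum.inr))) : L.Formula (Z ⊕ (Fin m ⊕ Y))) (Sum.elim c b),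
    fun z => ?_⟩
  rw [mem_instanceSet, Formula.realize_relabel, ← realize_instanceLE]
  have : Sum.elim z (Sum.elim c b) ∘ (Sum.elim (Sum.inr ∘ Sum.inl)
      (Sum.elim Sum.inl (Sum.inr ∘ Sum.inr))) = Sum.elim c (Sum.elim z b) := by
    funext t
    rcases t with t | t | t <;> rfl
  rw [this]

theorem exists_mem_iff_instanceSet_le {X Y Z : Type} [Finite X] (φ : L.Formula (X ⊕ (Z ⊕ Y)))
    (b : Y → M) (θ : L.DefinableSet (Set.univ : Set M) X) :
    ∃ ψ : L.DefinableSet (Set.univ : Set M) Z, ∀ z,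
      z ∈ ψ ↔ instanceSet φ (Sum.elim z b) ≤ θ := by
  obtain ⟨ψ, hψ⟩ := exists_mem_iff_le_instanceSet φ.not b θᶜ
  refine ⟨ψ, fun z => ?_⟩
  rw [hψ, ← instanceSet_compl, compl_le_compl_iff_le]

section Blocks

variable {d : ℕ} {n : Fin d → ℕ}

/-- Replace the `i`-th block of variables of `x` by `a`. -/
def replaceBlock (x : (Σ i : Fin d, Fin (n i)) → M) (i : Fin d) (a : Fin (n i) → M) :
    (Σ i : Fin d, Fin (n i)) → M :=
  fun p => Function.update (fun k j => x ⟨k, j⟩) i a p.1 p.2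

theorem replaceBlock_self (x : (Σ i : Fin d, Fin (n i)) → M) (i : Fin d) :
    replaceBlock x i (fun j => x ⟨i, j⟩) = x := by
  funext p
  rw [replaceBlock, Function.update_eq_self]

/-- Membership in `D` depends only on the blocks of variables in `s`. -/
def DefinableSet.DependsOn (D : L.DefinableSet (Set.univ : Set M) (Σ i : Fin d, Fin (n i)))
    (s : Finset (Fin d)) : Prop :=
  ∀ x y : (Σ i : Fin d, Fin (n i)) → M, (∀ i ∈ s, ∀ j, x ⟨i, j⟩ = y ⟨i, j⟩) → (x ∈ D ↔ y ∈ D)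

theorem DefinableSet.DependsOn.sdiff
    {D E : L.DefinableSet (Set.univ : Set M) (Σ i : Fin d, Fin (n i))} {s : Finset (Fin d)}
    (hD : D.DependsOn s) (hE : E.DependsOn s) : (D \ E).DependsOn s := by
  intro x y h
  rw [DefinableSet.mem_sdiff, DefinableSet.mem_sdiff, hD x y h, hE x y h]

/-- This turns the fibres over block `i` into instances of one formula, to which a cutting applies.
Block `i` of the parameter `x` is overwritten and has no influence. -/
theorem exists_formula_replaceBlock (i : Fin d) {m : ℕ}
    (φ : L.Formula ((Σ i : Fin d, Fin (n i)) ⊕ Fin m)) :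
    ∃ φ' : L.Formula (Fin (n i) ⊕ ((Σ i : Fin d, Fin (n i)) ⊕ Fin m)),
      ∀ (x : (Σ i : Fin d, Fin (n i)) → M) (a : Fin (n i) → M) (b : Fin m → M),
        φ'.Realize (Sum.elim a (Sum.elim x b)) ↔
          φ.Realize (Sum.elim (replaceBlock x i a) b) := by
  let σ : ∀ k : Fin d, Fin (n k) → Fin (n i) ⊕ ((Σ i : Fin d, Fin (n i)) ⊕ Fin m) :=
    Function.update (fun k j => Sum.inr (Sum.inl ⟨k, j⟩)) i fun j => Sum.inl j
  refine ⟨φ.relabel (Sum.elim (fun p => σ p.1 p.2) (Sum.inr ∘ Sum.inr)), fun x a b => ?_⟩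
  rw [Formula.realize_relabel]
  apply iff_of_eq
  congr 1
  funext t
  rcases t with ⟨k, j⟩ | t
  · simp only [Function.comp, Sum.elim_inl, replaceBlock, σ]
    by_cases h : k = i
    · subst h
      simp
    · simp [Function.update_of_ne h]
  · rfl

namespace KeislerMeasure

variable {ω : KeislerMeasure L M (Σ i : Fin d, Fin (n i))}

/-- Finitely many pairs sandwich all fibres of `D` over block `i`. The points whose fibre lies
between `p.1` and `p.2` form a definable set depending only on the blocks in `s`; making these sets
disjoint gives `χ`. -/
theorem UniqueExtension.exists_partition [Nonempty M] {i : Fin d}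
    (hω : UniqueExtension.{u, v, w, max w w'} (ω.marginal i)) {s : Finset (Fin d)}
    {D : L.DefinableSet (Set.univ : Set M) (Σ i : Fin d, Fin (n i))}
    (hD : D.DependsOn (insert i s)) {ε : ℝ} (hε : 0 < ε) :
    ∃ (F : Finset (L.DefinableSet (Set.univ : Set M) (Fin (n i)) ×
        L.DefinableSet (Set.univ : Set M) (Fin (n i))))
      (χ : L.DefinableSet (Set.univ : Set M) (Fin (n i)) ×
        L.DefinableSet (Set.univ : Set M) (Fin (n i)) →
        L.DefinableSet (Set.univ : Set M) (Σ i : Fin d, Fin (n i))),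
      (∀ p ∈ F, ω.meas (cylinder i p.2) - ω.meas (cylinder i p.1) < ε) ∧
      (∀ p, (χ p).DependsOn s) ∧ (F : Set _).PairwiseDisjoint χ ∧ F.sup χ = ⊤ ∧
      (∀ p, cylinder i p.1 ⊓ χ p ≤ D) ∧ ∀ p, D ⊓ χ p ≤ cylinder i p.2 := by
  classical
  obtain ⟨m, φ, b, rfl⟩ := exists_eq_instanceSet D
  obtain ⟨φ', hφ'⟩ := exists_formula_replaceBlock (M := M) i φ
  obtain ⟨F, hF, hcov⟩ := hω.exists_cutting φ' hε
  choose ψ₀ hψ₀ using fun θ => exists_mem_iff_le_instanceSet φ' b θ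
  choose ψ₁ hψ₁ using fun θ => exists_mem_iff_instanceSet_le φ' b θ
  have hagree : ∀ x y : (Σ i : Fin d, Fin (n i)) → M, (∀ k ∈ s, ∀ j, x ⟨k, j⟩ = y ⟨k, j⟩) →
      instanceSet φ' (Sum.elim x b) = instanceSet φ' (Sum.elim y b) := by
    intro x y hxy
    apply SetLike.ext
    intro a
    rw [mem_instanceSet, mem_instanceSet, hφ', hφ']
    refine hD _ _ fun k hk j => ?_
    simp only [replaceBlock]
    by_cases h : k = i
    · subst h
      simp
    · simp only [Function.update_of_ne h]
      exact hxy k ((Finset.mem_insert.1 hk).resolve_left h) j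
  have hmem : ∀ x : (Σ i : Fin d, Fin (n i)) → M, x ∈ instanceSet φ b ↔
      (fun j => x ⟨i, j⟩) ∈ instanceSet φ' (Sum.elim x b) := by
    intro x
    rw [mem_instanceSet, mem_instanceSet, hφ', replaceBlock_self]
  have hψ : ∀ p : L.DefinableSet (Set.univ : Set M) (Fin (n i)) ×
      L.DefinableSet (Set.univ : Set M) (Fin (n i)), (ψ₀ p.1 ⊓ ψ₁ p.2).DependsOn s := by
    intro p x y hxy
    rw [DefinableSet.mem_inf, DefinableSet.mem_inf, hψ₀, hψ₀, hψ₁, hψ₁, hagree x y hxy]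
  obtain ⟨χ, hχ, hχψ, hdisj, hsup⟩ := exists_pairwiseDisjoint_sup_eq
    (P := fun E : L.DefinableSet (Set.univ : Set M) (Σ i : Fin d, Fin (n i)) => E.DependsOn s)
    (fun _ _ h h' => h.sdiff h') hψ F
  refine ⟨F, χ, hF, hχ, hdisj, ?_, fun p x hx => ?_, fun p x hx => ?_⟩
  · rw [hsup, eq_top_iff]
    intro x _
    obtain ⟨p, hp, h0, h1⟩ := hcov (Sum.elim x b)
    exact (Finset.le_sup (f := fun p : L.DefinableSet (Set.univ : Set M) (Fin (n i)) ×
      L.DefinableSet (Set.univ : Set M) (Fin (n i)) => ψ₀ p.1 ⊓ ψ₁ p.2) hp)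
      ⟨(hψ₀ _ _).2 h0, (hψ₁ _ _).2 h1⟩
  · exact (hmem x).2 ((hψ₀ _ _).1 (hχψ p hx.2).1 hx.1)
  · exact (hψ₁ _ _).1 (hχψ p hx.2).2 ((hmem x).1 hx.1)

/-- The conditional measure given a set of positive measure. -/
noncomputable def cond {X : Type} (ν : KeislerMeasure L M X)
    (E : L.DefinableSet (Set.univ : Set M) X) (hE : ν.meas E ≠ 0) : KeislerMeasure L M X where
  meas D := ν.meas (D ⊓ E) / ν.meas E
  nonneg D := div_nonneg (ν.nonneg _) (ν.nonneg _)
  meas_top := by rw [top_inf_eq, div_self hE]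
  meas_sup D D' h := by
    rw [inf_sup_right, ν.meas_sup _ _ (h.mono inf_le_left inf_le_left), add_div]

theorem meas_cylinder_top (i : Fin d) : ω.meas (cylinder i ⊤) = 1 := ω.meas_top

theorem box_update_of_eq_top {A : ∀ i : Fin d, L.DefinableSet (Set.univ : Set M) (Fin (n i))}
    {i : Fin d} (hA : A i = ⊤) (θ : L.DefinableSet (Set.univ : Set M) (Fin (n i))) :
    box (Function.update A i θ) = box A ⊓ cylinder i θ := by
  apply SetLike.ext
  intro x
  rw [DefinableSet.mem_inf, mem_box, mem_box, mem_cylinder]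
  constructor
  · intro h
    refine ⟨fun k => ?_, ?_⟩
    · by_cases hk : k = i
      · subst hk
        rw [hA]
        exact DefinableSet.mem_top
      · have h1 := h k
        rwa [Function.update_of_ne hk] at h1
    · have h1 := h i
      rwa [Function.update_self] at h1
  · rintro ⟨h1, h2⟩ k
    by_cases hk : k = i
    · subst hk
      rwa [Function.update_self]
    · rw [Function.update_of_ne hk]
      exact h1 k

theorem IsProduct.meas_box_update (hω : ω.IsProduct)
    {A : ∀ i : Fin d, L.DefinableSet (Set.univ : Set M) (Fin (n i))}
    {i : Fin d} (hA : A i = ⊤) (θ : L.DefinableSet (Set.univ : Set M) (Fin (n i))) :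
    ω.meas (box (Function.update A i θ)) = ω.meas (cylinder i θ) * ω.meas (box A) := by
  rw [hω, hω, ← Finset.mul_prod_erase _ _ (Finset.mem_univ i),
    ← Finset.mul_prod_erase _ (fun k => (ω.marginal k).meas (A k)) (Finset.mem_univ i),
    Function.update_self, hA, (ω.marginal i).meas_top, one_mul]
  congr 1
  refine Finset.prod_congr rfl fun k hk => ?_
  rw [Function.update_of_ne (Finset.ne_of_mem_erase hk)]

/-- Conditioned on `cylinder i θ`, the measure `ν` agrees with `ω` on the boxes over `s`, so `hψ`
gives its value at `ψ`. For this step `hψ` has to cover all measures with the right values at boxes.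
-/
theorem IsProduct.meas_cylinder_inf (hω : ω.IsProduct) {i : Fin d} {s : Finset (Fin d)}
    (his : i ∉ s)
    {ψ : L.DefinableSet (Set.univ : Set M) (Σ i : Fin d, Fin (n i))}
    (hψ : ∀ ν : KeislerMeasure L M (Σ i : Fin d, Fin (n i)),
      (∀ A, (∀ i ∉ s, A i = ⊤) → ν.meas (box A) = ω.meas (box A)) → ν.meas ψ = ω.meas ψ)
    {ν : KeislerMeasure L M (Σ i : Fin d, Fin (n i))}
    (hν : ∀ A, (∀ k ∉ insert i s, A k = ⊤) → ν.meas (box A) = ω.meas (box A))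
    (θ : L.DefinableSet (Set.univ : Set M) (Fin (n i))) :
    ν.meas (cylinder i θ ⊓ ψ) = ω.meas (cylinder i θ) * ω.meas ψ := by
  classical
  have hbox : ∀ A, (∀ k ∉ s, A k = ⊤) → ν.meas (box A ⊓ cylinder i θ) =
      ω.meas (cylinder i θ) * ω.meas (box A) := by
    intro A hA
    rw [← box_update_of_eq_top (hA i his), hν, hω.meas_box_update (hA i his)]
    intro k hk
    rw [Finset.mem_insert, not_or] at hk
    rw [Function.update_of_ne hk.1, hA k hk.2]
  have htop : box (fun k : Fin d => (⊤ : L.DefinableSet (Set.univ : Set M) (Fin (n k)))) = ⊤ := by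
    rw [eq_top_iff]
    intro x _
    exact mem_box.2 fun _ => DefinableSet.mem_top
  have hcyl : ν.meas (cylinder i θ) = ω.meas (cylinder i θ) := by
    have h := hbox (fun _ => ⊤) fun _ _ => rfl
    rwa [htop, top_inf_eq, ω.meas_top, mul_one] at h
  by_cases h0 : ν.meas (cylinder i θ) = 0
  · have h1 := ν.meas_mono (inf_le_left : cylinder i θ ⊓ ψ ≤ cylinder i θ)
    rw [← hcyl, h0, zero_mul]
    exact le_antisymm (h1.trans h0.le) (ν.nonneg _)
  · have h1 := hψ (ν.cond _ h0) fun A hA => by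
      change ν.meas (box A ⊓ cylinder i θ) / ν.meas (cylinder i θ) = _
      rw [hbox A hA, hcyl, mul_div_cancel_left₀ _ (hcyl ▸ h0)]
    change ν.meas (ψ ⊓ cylinder i θ) / ν.meas (cylinder i θ) = _ at h1
    rw [div_eq_iff h0, inf_comm] at h1
    rw [h1, hcyl, mul_comm]

theorem sum_meas_inf_eq {X : Type} {ι : Type*} {ν : KeislerMeasure L M X} {F : Finset ι}
    {χ : ι → L.DefinableSet (Set.univ : Set M) X} (hd : (F : Set ι).PairwiseDisjoint χ)
    (hs : F.sup χ = ⊤) (D : L.DefinableSet (Set.univ : Set M) X) :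
    ∑ p ∈ F, ν.meas (D ⊓ χ p) = ν.meas D := by
  rw [← ν.meas_finset_sup F fun p => D ⊓ χ p, ← Finset.sup_inf_distrib_left, hs, inf_top_eq]
  exact fun p hp q hq hpq => (hd hp hq hpq).mono inf_le_right inf_le_right

/-- A product measure whose marginals have unique extensions is determined by its values at the
boxes, and every set of positive measure contains a box of positive measure. -/
theorem IsProduct.dependsOn_induction [Nonempty M] (hω : ω.IsProduct)
    (hext : ∀ i, UniqueExtension.{u, v, w, max w w'} (ω.marginal i)) (s : Finset (Fin d)) :
    ∀ D : L.DefinableSet (Set.univ : Set M) (Σ i : Fin d, Fin (n i)), D.DependsOn s →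
      (∀ ν : KeislerMeasure L M (Σ i : Fin d, Fin (n i)),
        (∀ A, (∀ i ∉ s, A i = ⊤) → ν.meas (box A) = ω.meas (box A)) → ν.meas D = ω.meas D) ∧
      (0 < ω.meas D → ∃ A, (∀ i, 0 < ω.meas (cylinder i (A i))) ∧ (∀ i ∉ s, A i = ⊤) ∧
        box A ≤ D) := by
  classical
  induction s using Finset.induction_on with
  | empty =>
    intro D hD
    have h : D = ⊥ ∨ D = ⊤ := by
      by_cases h : ∃ x, x ∈ D
      · obtain ⟨x, hx⟩ := h
        right
        rw [eq_top_iff]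
        exact fun y _ => (hD x y (by simp)).1 hx
      · left
        rw [eq_bot_iff]
        exact fun y hy => (h ⟨y, hy⟩).elim
    rcases h with rfl | rfl
    · refine ⟨fun ν _ => by rw [meas_bot, meas_bot], fun h => ?_⟩
      rw [meas_bot] at h
      exact (lt_irrefl _ h).elim
    · exact ⟨fun ν _ => by rw [ν.meas_top, ω.meas_top], fun _ => ⟨fun _ => ⊤,
        fun i => by rw [meas_cylinder_top]; exact one_pos, fun _ _ => rfl, le_top⟩⟩
  | insert i s his ih =>
    intro D hD
    -- Up to `ε`, every such `ν` takes at `D` the same value, a sum in which only `ω` occurs.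
    -- Comparing `ν` with `ω` for all `ε` gives uniqueness; for `ε = ω.meas D / 2` the sum has a
    -- positive term, and induction in its factor `χ p` yields the box.
    have hsand : ∀ ε : ℝ, 0 < ε → ∃ (F : Finset (L.DefinableSet (Set.univ : Set M) (Fin (n i)) ×
          L.DefinableSet (Set.univ : Set M) (Fin (n i))))
        (χ : L.DefinableSet (Set.univ : Set M) (Fin (n i)) ×
          L.DefinableSet (Set.univ : Set M) (Fin (n i)) →
          L.DefinableSet (Set.univ : Set M) (Σ i : Fin d, Fin (n i))),
        (∀ p, (χ p).DependsOn s) ∧ (∀ p, cylinder i p.1 ⊓ χ p ≤ D) ∧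
        ∀ ν : KeislerMeasure L M (Σ i : Fin d, Fin (n i)),
          (∀ A, (∀ k ∉ insert i s, A k = ⊤) → ν.meas (box A) = ω.meas (box A)) →
          ∑ p ∈ F, ω.meas (cylinder i p.1) * ω.meas (χ p) ≤ ν.meas D ∧
          ν.meas D ≤ ∑ p ∈ F, ω.meas (cylinder i p.1) * ω.meas (χ p) + ε := by
      intro ε hε
      obtain ⟨F, χ, hF, hχ, hdisj, hsup, h0, h1⟩ := (hext i).exists_partition hD hε
      refine ⟨F, χ, hχ, h0, fun ν hν => ?_⟩
      have hmul := fun θ p => hω.meas_cylinder_inf his (ih _ (hχ p)).1 hν θ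
      rw [← sum_meas_inf_eq hdisj hsup D]
      constructor
      · refine Finset.sum_le_sum fun p _ => ?_
        rw [← hmul]
        exact ν.meas_mono (le_inf (h0 p) inf_le_right)
      · have h2 : ∑ p ∈ F, ω.meas (χ p) = 1 := by
          rw [← ω.meas_finset_sup F χ hdisj, hsup, ω.meas_top]
        calc ∑ p ∈ F, ν.meas (D ⊓ χ p) ≤
            ∑ p ∈ F, (ω.meas (cylinder i p.1) * ω.meas (χ p) + ε * ω.meas (χ p)) := by
              refine Finset.sum_le_sum fun p hp => ?_
              have h3 := ν.meas_mono (le_inf (h1 p) inf_le_right : D ⊓ χ p ≤ _)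
              rw [hmul] at h3
              refine h3.trans ?_
              rw [← add_mul]
              exact mul_le_mul_of_nonneg_right (by linarith [hF p hp]) (ω.nonneg _)
          _ = _ := by rw [Finset.sum_add_distrib, ← Finset.mul_sum, h2, mul_one]
    refine ⟨fun ν hν => ?_, fun hpos => ?_⟩
    · refine eq_of_forall_dist_le fun ε hε => ?_
      obtain ⟨F, χ, -, -, h⟩ := hsand ε hε
      obtain ⟨h1, h2⟩ := h ν hν
      obtain ⟨h3, h4⟩ := h ω fun _ _ => rfl
      rw [Real.dist_eq, abs_le]
      constructor <;> linarith
    · obtain ⟨F, χ, hχ, h0, h⟩ := hsand (ω.meas D / 2) (half_pos hpos)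
      obtain ⟨-, h1⟩ := h ω fun _ _ => rfl
      have h2 : 0 < ∑ p ∈ F, ω.meas (cylinder i p.1) * ω.meas (χ p) := by linarith
      obtain ⟨p, -, hp⟩ := Finset.exists_lt_of_sum_lt (s := F) (f := fun _ => (0 : ℝ))
        (g := fun p => ω.meas (cylinder i p.1) * ω.meas (χ p)) (by simpa using h2)
      have hp1 : 0 < ω.meas (cylinder i p.1) := pos_of_mul_pos_left hp (ω.nonneg _)
      have hp2 : 0 < ω.meas (χ p) := pos_of_mul_pos_right hp (ω.nonneg _)
      obtain ⟨A, hA, hAs, hbox⟩ := (ih _ (hχ p)).2 hp2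
      refine ⟨Function.update A i p.1, fun k => ?_, fun k hk => ?_, ?_⟩
      · by_cases hk : k = i
        · subst hk
          rwa [Function.update_self]
        · rw [Function.update_of_ne hk]
          exact hA k
      · rw [Finset.mem_insert, not_or] at hk
        rw [Function.update_of_ne hk.1, hAs k hk.2]
      · rw [box_update_of_eq_top (hAs i his), inf_comm]
        exact (inf_le_inf_left _ hbox).trans (h0 p)

theorem IsProduct.exists_box_le [Nonempty M] (hω : ω.IsProduct)
    (hext : ∀ i, UniqueExtension.{u, v, w, max w w'} (ω.marginal i))
    {D : L.DefinableSet (Set.univ : Set M) (Σ i : Fin d, Fin (n i))} (hD : 0 < ω.meas D) :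
    ∃ A, (∀ i, 0 < (ω.marginal i).meas (A i)) ∧ box A ≤ D := by
  obtain ⟨A, hA, -, hbox⟩ := (hω.dependsOn_induction hext Finset.univ D
    fun x y hxy => by
      have h : x = y := funext fun p => hxy p.1 (Finset.mem_univ _) p.2
      rw [h]).2 hD
  exact ⟨A, hA, hbox⟩

theorem IsGenericallyStable.marginal (hω : ω.IsGenericallyStable) (i : Fin d) :
    (ω.marginal i).IsGenericallyStable := by
  intro m φ ε hε
  obtain ⟨k, a, hk, ha⟩ := hω m (φ.relabel (Sum.map (fun j => ⟨i, j⟩) id)) ε hε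
  refine ⟨k, fun t j => a t ⟨i, j⟩, hk, fun b => ?_⟩
  have h := ha b
  have h1 : ∀ x : (Σ i : Fin d, Fin (n i)) → M,
      (φ.relabel (Sum.map (fun j => (⟨i, j⟩ : Σ i : Fin d, Fin (n i))) id)).Realize
        (Sum.elim x b) ↔ φ.Realize (Sum.elim (fun j => x ⟨i, j⟩) b) := by
    intro x
    rw [Formula.realize_relabel, Sum.elim_comp_map]
    rfl
  have h2 : instanceSet (φ.relabel (Sum.map (fun j => (⟨i, j⟩ : Σ i : Fin d, Fin (n i))) id)) b =
      cylinder i (instanceSet φ b) := SetLike.ext fun x => h1 x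
  rw [h2] at h
  simp only [h1] at h
  exact h

end KeislerMeasure

end Blocks

/-! ### Merging finitely many templates, and uniformity over all models. -/

section Switch

variable {L : Language.{u, v}} {M : Type w} [L.Structure M] {X : Type} {k l : ℕ}

/-- A formula whose instances include those of `θ` and, if there are at least two elements, those
of `θ'`: two additional parameters select one of the formulas by being equal or not. -/
noncomputable def switchFormula (θ : L.Formula (X ⊕ Fin k)) (θ' : L.Formula (X ⊕ Fin l)) :
    L.Formula (X ⊕ Fin (k + (l + 2))) :=
  let E : L.Formula (X ⊕ Fin (k + (l + 2))) :=
    Term.equal (Term.var (Sum.inr (Fin.natAdd k (Fin.natAdd l 0))))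
      (Term.var (Sum.inr (Fin.natAdd k (Fin.natAdd l 1))))
  (E ⊓ θ.relabel (Sum.map id (Fin.castAdd (l + 2)))) ⊔
    (E.not ⊓ θ'.relabel (Sum.map id fun j => Fin.natAdd k (Fin.castAdd 2 j)))

open Classical in
theorem instanceSet_switchFormula (θ : L.Formula (X ⊕ Fin k)) (θ' : L.Formula (X ⊕ Fin l))
    (c : Fin k → M) (c' : Fin l → M) (e : Fin 2 → M) :
    instanceSet (switchFormula θ θ') (Fin.append c (Fin.append c' e)) =
      if e 0 = e 1 then instanceSet θ c else instanceSet θ' c' := by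
  apply SetLike.ext
  intro x
  have h1 : Fin.append c (Fin.append c' e) ∘ Fin.castAdd (l + 2) = c := by
    funext j
    simp
  have h2 : (Fin.append c (Fin.append c' e) ∘ fun j => Fin.natAdd k (Fin.castAdd 2 j)) = c' := by
    funext j
    simp
  rw [mem_instanceSet, switchFormula]
  simp only [Formula.realize_sup, Formula.realize_inf, Formula.realize_not,
    Formula.realize_equal, Formula.realize_relabel, Sum.elim_comp_map, h1, h2, Term.realize_var,
    Sum.elim_inr, Fin.append_right, Function.comp_id]
  split_ifs with h
  · simp [h, mem_instanceSet]
  · simp [h, mem_instanceSet]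

theorem exists_switchFormula_left [Nonempty M] (θ : L.Formula (X ⊕ Fin k))
    (θ' : L.Formula (X ⊕ Fin l)) (c : Fin k → M) :
    ∃ c', instanceSet (switchFormula θ θ') c' = instanceSet θ c := by
  let e := Classical.arbitrary M
  exact ⟨Fin.append c (Fin.append (fun _ => e) fun _ => e), by
    rw [instanceSet_switchFormula, if_pos rfl]⟩

theorem exists_switchFormula_right [Nontrivial M] (θ : L.Formula (X ⊕ Fin k))
    (θ' : L.Formula (X ⊕ Fin l)) (c : Fin l → M) :
    ∃ c', instanceSet (switchFormula θ θ') c' = instanceSet θ' c := by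
  obtain ⟨a, b, hab⟩ := exists_pair_ne M
  exact ⟨Fin.append (fun _ => a) (Fin.append c ![a, b]), by
    rw [instanceSet_switchFormula, if_neg (by simpa using hab)]⟩

end Switch

/-- Formulas for the sides of a box, and a lower bound `1 / (q + 2)` for their measures. -/
structure BoxTemplate (L : Language.{u, v}) {d : ℕ} (n : Fin d → ℕ) where
  /-- The lower bound is `1 / (q + 2)`. -/
  q : ℕ
  /-- The number of parameters of each side. -/
  arity : Fin d → ℕ
  /-- The formula that defines each side. -/
  side : ∀ i : Fin d, L.Formula (Fin (n i) ⊕ Fin (arity i))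

namespace BoxTemplate

variable {L : Language.{u, v}} {d : ℕ} {n : Fin d → ℕ}

/-- Some box of the given form, with sides of measure more than the bound, is contained in `D`. -/
def Fits (t : BoxTemplate L n) {M : Type w} [L.Structure M]
    (ω : KeislerMeasure L M (Σ i : Fin d, Fin (n i)))
    (D : L.DefinableSet (Set.univ : Set M) (Σ i : Fin d, Fin (n i))) : Prop :=
  ∃ c : ∀ i : Fin d, Fin (t.arity i) → M,
    (∀ i, 1 / ((t.q : ℝ) + 2) < (ω.marginal i).meas (instanceSet (t.side i) (c i))) ∧
    box (fun i => instanceSet (t.side i) (c i)) ≤ D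

/-- A template that subsumes `t` and, over models with at least two elements, `t'`. -/
noncomputable def switch (t t' : BoxTemplate L n) : BoxTemplate L n where
  q := max t.q t'.q
  arity i := t.arity i + (t'.arity i + 2)
  side i := switchFormula (t.side i) (t'.side i)

variable {M : Type w} [L.Structure M] {ω : KeislerMeasure L M (Σ i : Fin d, Fin (n i))}
  {D : L.DefinableSet (Set.univ : Set M) (Σ i : Fin d, Fin (n i))}

theorem Fits.switch_left [Nonempty M] {t : BoxTemplate L n} (t' : BoxTemplate L n)
    (h : t.Fits ω D) : (t.switch t').Fits ω D := by
  obtain ⟨c, hc, hbox⟩ := h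
  choose c' hc' using fun i => exists_switchFormula_left (t.side i) (t'.side i) (c i)
  refine ⟨c', fun i => ?_, ?_⟩
  · change 1 / (((max t.q t'.q : ℕ) : ℝ) + 2) <
      (ω.marginal i).meas (instanceSet (switchFormula (t.side i) (t'.side i)) (c' i))
    rw [hc']
    refine lt_of_le_of_lt ?_ (hc i)
    have : (t.q : ℝ) ≤ ((max t.q t'.q : ℕ) : ℝ) := by exact_mod_cast le_max_left _ _
    gcongr
  · change box (fun i => instanceSet (switchFormula (t.side i) (t'.side i)) (c' i)) ≤ D
    simpa only [hc'] using hbox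

theorem Fits.switch_right [Nontrivial M] (t : BoxTemplate L n) {t' : BoxTemplate L n}
    (h : t'.Fits ω D) : (t.switch t').Fits ω D := by
  obtain ⟨c, hc, hbox⟩ := h
  choose c' hc' using fun i => exists_switchFormula_right (t.side i) (t'.side i) (c i)
  refine ⟨c', fun i => ?_, ?_⟩
  · change 1 / (((max t.q t'.q : ℕ) : ℝ) + 2) <
      (ω.marginal i).meas (instanceSet (switchFormula (t.side i) (t'.side i)) (c' i))
    rw [hc']
    refine lt_of_le_of_lt ?_ (hc i)
    have : (t'.q : ℝ) ≤ ((max t.q t'.q : ℕ) : ℝ) := by exact_mod_cast le_max_right _ _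
    gcongr
  · change box (fun i => instanceSet (switchFormula (t.side i) (t'.side i)) (c' i)) ≤ D
    simpa only [hc'] using hbox

/-- Finitely many templates are subsumed by a single one. -/
theorem exists_subsuming (F : Finset (BoxTemplate L n)) : ∃ t₀ : BoxTemplate L n,
    ∀ (M : Type w) [L.Structure M] [Nonempty M]
      (ω : KeislerMeasure L M (Σ i : Fin d, Fin (n i)))
      (D : L.DefinableSet (Set.univ : Set M) (Σ i : Fin d, Fin (n i))), 0 < ω.meas D →
      (Subsingleton M ∨ ∃ t ∈ F, t.Fits ω D) → t₀.Fits ω D := by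
  classical
  induction F using Finset.induction_on with
  | empty =>
    -- Over a one-element model a set of positive measure is everything, so full sides do. The bound
    -- is `1 / 2`; with `q + 1` in place of `q + 2` it would be 1, which no measure exceeds.
    refine ⟨⟨0, fun _ => 0, fun _ => ⊤⟩, fun M _ _ ω D hD h => ?_⟩
    have hM : Subsingleton M := h.resolve_right (by simp)
    have htop : ∀ i, instanceSet (⊤ : L.Formula (Fin (n i) ⊕ Fin 0)) (fun j => j.elim0 : Fin 0 → M) =
        ⊤ := by
      intro i
      rw [eq_top_iff]
      intro x _
      rw [mem_instanceSet]
      simp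
    refine ⟨fun _ j => j.elim0, fun i => ?_, ?_⟩
    · rw [htop, (ω.marginal i).meas_top]
      norm_num
    · obtain ⟨x, hx⟩ : ∃ x, x ∈ D := by
        by_contra! hne
        have : D = ⊥ := by
          rw [eq_bot_iff]
          exact fun x hx => (hne x hx).elim
        rw [this, ω.meas_bot] at hD
        exact lt_irrefl _ hD
      intro y _
      rwa [Subsingleton.elim y x]
  | insert t F ht ih =>
    obtain ⟨t₀, h₀⟩ := ih
    refine ⟨t₀.switch t, fun M _ _ ω D hD h => ?_⟩
    rcases subsingleton_or_nontrivial M with hM | hM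
    · exact (h₀ M ω D hD (Or.inl hM)).switch_left t
    · obtain ⟨t', ht', hfit⟩ := h.resolve_left (not_subsingleton M)
      rcases Finset.mem_insert.1 ht' with rfl | ht'
      · exact hfit.switch_right t₀
      · exact (h₀ M ω D hD (Or.inr ⟨t', ht', hfit⟩)).switch_left t

/-- Product measures over models of a distal theory satisfy the strong Erdős–Hajnal property, with
bounds and formulas that do not depend on the model. -/
theorem exists_fits {T : L.Theory} (hT : T.IsDistal) {m : ℕ}
    (R : L.Formula ((Σ i : Fin d, Fin (n i)) ⊕ Fin m)) {α : ℝ} (hα : 0 < α) :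
    ∃ t : BoxTemplate L n, ∀ (M : Type w) [L.Structure M] [Nonempty M] [M ⊨ T] (b : Fin m → M)
      (ω : KeislerMeasure L M (Σ i : Fin d, Fin (n i))), ω.IsProduct → ω.IsGenericallyStable →
        α ≤ ω.meas (instanceSet R b) → t.Fits ω (instanceSet R b) := by
  classical
  -- For each finite set `F` of templates, a counterexample to the template subsuming `F` is chosen.
  -- The ultrafilter makes any given template belong to almost all `F`.
  by_contra! hne
  choose t₀ ht₀ using exists_subsuming.{u, v, w} (L := L) (n := n)
  choose M _ _ hM b ω hprod hstab hR hfit using fun F => hne (t₀ F)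
  let U : Ultrafilter (Finset (BoxTemplate L n)) := Ultrafilter.of Filter.atTop
  have hU : (U : Filter (Finset (BoxTemplate L n))) ≤ Filter.atTop := Ultrafilter.of_le _
  let Ω := KeislerMeasure.ultraproduct U ω
  have hmod : (U : Filter (Finset (BoxTemplate L n))).Product M ⊨ T := Ultraproduct.models hM
  have hstabΩ : Ω.IsGenericallyStable := KeislerMeasure.IsGenericallyStable.ultraproduct hT.1 hM hstab
  have hRlim := DefinableSet.isLimit_instanceSet (U := U) R b
  have hRpos : 0 < Ω.meas (instanceSet R (Ultraproduct.tuple U b)) :=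
    hα.trans_le (ge_of_tendsto' (KeislerMeasure.tendsto_ultraproduct ω hRlim) hR)
  obtain ⟨A, hA, hbox⟩ := (KeislerMeasure.IsProduct.ultraproduct hprod).exists_box_le
    (fun i => hT.uniqueExtension.{u, v, max u v w, max u v w} (hstabΩ.marginal i)) hRpos
  choose k θ c hc using fun i => exists_eq_instanceSet (A i)
  choose c' hc' using fun i => Ultraproduct.exists_tuple (c i)
  have hlim : ∀ i, (A i).IsLimit fun F => instanceSet (θ i) (c' i F) := by
    intro i
    rw [hc i, ← hc' i]
    exact DefinableSet.isLimit_instanceSet _ _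
  choose q hq using fun i => exists_nat_one_div_lt (hA i)
  -- The sides in the ultraproduct have measure above `1 / (q i + 1)`, hence strictly above the
  -- bound of `t`, and a strict inequality for a limit holds in almost all factors.
  let t : BoxTemplate L n := ⟨Finset.univ.sup q, k, θ⟩
  have h1 : ∀ᶠ F in U, ∀ i, 1 / ((t.q : ℝ) + 2) <
      ((ω F).marginal i).meas (instanceSet (θ i) (c' i F)) := by
    rw [Filter.eventually_all]
    intro i
    refine (KeislerMeasure.tendsto_ultraproduct ω
      (DefinableSet.isLimit_cylinder (hlim i))).eventually_const_lt ?_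
    refine lt_of_le_of_lt ?_ (hq i)
    have : (q i : ℝ) ≤ (t.q : ℝ) := by
      exact_mod_cast Finset.le_sup (f := q) (Finset.mem_univ i)
    gcongr
    linarith
  have h2 := ((DefinableSet.isLimit_box (B := fun F i => instanceSet (θ i) (c' i F)) hlim).le_iff
    hRlim).1 hbox
  have h3 : ∀ᶠ F in (U : Filter (Finset (BoxTemplate L n))), t ∈ F := by
    filter_upwards [hU (Filter.mem_atTop {t})] with F hF
    exact hF (Finset.mem_singleton_self t)
  obtain ⟨F, hF1, hF2, hF3⟩ := (h1.and (h2.and h3)).exists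
  exact hfit F (ht₀ F (M F) (ω F) _ (hα.trans_le (hR F))
    (Or.inr ⟨t, hF3, fun i => c' i F, hF1, hF2⟩))

end BoxTemplate

end FirstOrder.Language

theorem theorem2p2 {L : FirstOrder.Language.{u, v}} (T : L.Theory) (hT : T.IsDistal)
    {d m : ℕ} (n : Fin d → ℕ) (R : L.Formula ((Σ i : Fin d, Fin (n i)) ⊕ Fin m))
    (α : ℝ) (hα : 0 < α) :
    ∃ (δ : ℝ) (k : Fin d → ℕ) (θ : ∀ i : Fin d, L.Formula (Fin (n i) ⊕ Fin (k i))), 0 < δ ∧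
      ∀ (M : Type w) [L.Structure M] [Nonempty M] [M ⊨ T] (b : Fin m → M)
        (ω : KeislerMeasure L M (Σ i : Fin d, Fin (n i))), ω.IsProduct →
        (ω.IsGenericallyStable ↔ ω.IsSmooth) ∧
        (ω.IsGenericallyStable → α ≤ ω.meas (instanceSet R b) →
          ∃ c : ∀ i : Fin d, Fin (k i) → M,
            (∀ i, δ < (ω.marginal i).meas (instanceSet (θ i) (c i))) ∧
            box (fun i => instanceSet (θ i) (c i)) ≤ instanceSet R b) := by
  obtain ⟨t, ht⟩ := BoxTemplate.exists_fits.{u, v, w} hT R hα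
  exact ⟨1 / ((t.q : ℝ) + 2), t.arity, t.side, by positivity, fun M _ _ _ b ω hω =>
    ⟨hT.isGenericallyStable_iff_isSmooth ω, fun hs hR => ht M b ω hω hs hR⟩⟩
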